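/- Let $\mathbb K$ be a field of characteristic $0$, let $G$ be a finite abelian group acting linearly on an $n$-dimensional $\mathbb K$-vector space $V$, diagonally with respect to a basis $v_1,\dots,v_n$: ${}^g v_i=\chi_i(g)\,v_i$ with linear characters $\chi_i:G\to\mathbb K^{*}$. Let $\mathbf q=\{q_{ij}\}$ be nonzero scalars with $q_{ii}=1$ and $q_{ji}=q_{ij}^{-1}$, and let $\kappa:V\times V\to V\otimes\mathbb KG$ be bilinear with $\kappa(v_i,v_j)=-q_{ij}\,\kappa(v_j,v_i)$ for all $i,j$. Write $$\kappa(v,w)=\sum_{g\in G}\kappa_g(v,w)\otimes g,\qquad \kappa_g(v_i,v_j)=\sum_{r}c_r^{ijg}\,v_r ,$$ write $(v\otimes g)h=v\otimes gh$, and extend $\kappa$ to $V\otimes\mathbb KG$ by $\kappa(v\otimes g,w\otimes h)=\kappa(v,{}^g w)\,gh$, identifying $v$ with $v\otimes 1$. Let $$\mathcal H_{\mathbf q,\kappa}=(T(V)\rtimes G)/\big(v_iv_j-q_{ij}v_jv_i-\kappa(v_i,v_j):1\le i,j\le n\big),$$ where $v\otimes g$ is read as $vg\in T(V)\rtimes G$.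 It has the PBW property if the images of the elements $v_1^{m_1}\cdots v_n^{m_n}g$ ($m_i\in\mathbb N$, $g\in G$) form a $\mathbb K$-basis of it. Below, $\sum_{\circlearrowleft}$ is the sum over the cyclic permutations of $(i,j,k)$. The PBW conditions are: (1) $\kappa$ is $G$-invariant: $\kappa({}^g v,{}^g w)={}^g\kappa(v,w)$ for all $g\in G$ and $v,w\in V$, where ${}^g(v\otimes h)={}^gv\otimes ghg^{-1}$; (2) for all $g\in G$ and all distinct $i,j,k$: $0=(\chi_k(g)-q_{jk}q_{ik}q_{kr})\,c_r^{ijg}$ for every $r\ne i,j$, and $0=(1-q_{ij}\chi_i(g))\,c_k^{jkg}+(q_{jk}-\chi_k(g))\,c_i^{ijg}$; (3) for all distinct $i,j,k$: $$0=\sum_{g\in G}\Big(\sum_{\circlearrowleft}(\chi_k(g)-q_{jk})\,c_i^{ijg}\,\kappa(v_k,v_i)+\sum_{\circlearrowleft}q_{jk}\,\kappa\big(v_k,\kappa_g(v_i,v_j)\big)\Big)g .$$ Consider the three conditions: (1$'$) $\kappa$ is $G$-invariant; (2$'$) (vanishing condition) for all $g\in G$, all distinct $i,j,k$ and all $r$: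 if $c_r^{ijg}\neq 0$ then ${}^gv_k=q_{ik}q_{jk}q_{kr}\,v_k$; (3$'$) (quantum Jacobi identity) $0=\sum_{\circlearrowleft}q_{jk}\,\kappa\big(v_k,\kappa(v_i,v_j)\big)$ for all distinct $i,j,k$. Then (1$'$), (2$'$), (3$'$) together imply (1), (2), (3), and they imply that $\mathcal H_{\mathbf q,\kappa}$ has the PBW property. If moreover the action of $G$ on $V$ is fixed point free (no nonzero vector of $V$ is fixed by all of $G$), then (1), (2), (3) hold if and only if (1$'$), (2$'$), (3$'$) hold, and $\mathcal H_{\mathbf q,\kappa}$ has the PBW property if and only if (1$'$), (2$'$), (3$'$) hold. -/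

import Mathlib

open scoped TensorProduct

set_option linter.unusedSectionVars false

namespace QuantumDrinfeld

noncomputable section

/-! ### The skew group algebra `T(V) ⋊ G` -/

section SkewTensor

variable (K : Type*) [Field K] {G : Type*} [Group G] {V : Type*} [AddCommGroup V] [Module K V]
  [DistribMulAction G V] [SMulCommClass G K V]

/-- The algebra endomorphism of the tensor algebra `T(V)` extending the action of `g` on `V`. -/
def tensorAct (g : G) : TensorAlgebra K V →ₐ[K] TensorAlgebra K V :=
  TensorAlgebra.lift K (TensorAlgebra.ι K ∘ₗ DistribSMul.toLinearMap K V g)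

theorem tensorAct_ι (g : G) (v : V) :
    tensorAct K g (TensorAlgebra.ι K v) = TensorAlgebra.ι K (g • v) := by
  simp [tensorAct]

theorem tensorAct_one : tensorAct K (V := V) (1 : G) = AlgHom.id K _ := by
  apply TensorAlgebra.hom_ext
  ext v
  simp [tensorAct_ι]

theorem tensorAct_mul (g h : G) :
    tensorAct K (V := V) (g * h) = (tensorAct K g).comp (tensorAct K h) := by
  apply TensorAlgebra.hom_ext
  ext v
  simp [tensorAct_ι, mul_smul]

/-- `G` acts on `T(V)` by algebra automorphisms, extending its action on `V`. -/
instance tensorAction : MulSemiringAction G (TensorAlgebra K V) where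
  smul g x := tensorAct K g x
  one_smul x := by
    change tensorAct K (1 : G) x = x
    rw [tensorAct_one, AlgHom.id_apply]
  mul_smul g h x := by
    change tensorAct K (g * h) x = tensorAct K g (tensorAct K h x)
    rw [tensorAct_mul, AlgHom.comp_apply]
  smul_zero g := map_zero (tensorAct K g)
  smul_add g x y := map_add (tensorAct K g) x y
  smul_one g := map_one (tensorAct K g)
  smul_mul g x y := map_mul (tensorAct K g) x y

theorem smul_tensor_ι (g : G) (v : V) :
    g • TensorAlgebra.ι K v = TensorAlgebra.ι K (g • v) :=
  tensorAct_ι K g v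

instance tensorAction_comm : SMulCommClass G K (TensorAlgebra K V) where
  smul_comm g c x := map_smul (tensorAct K g) c x

variable (G V)

/-- The skew group algebra `T(V) ⋊ G`: its elements are the sums of `r g` (written `single g r`)
with `r ∈ T(V)` and `g ∈ G`, and `(r g) (s h) = r (g • s) (g h)`. -/
abbrev SkewTensor : Type _ := SkewMonoidAlgebra (TensorAlgebra K V) G

end SkewTensor

/-! ### The bimodule `V ⊗ K G` -/

section Bimodule

variable {K : Type*} [Field K] {G : Type*} [Group G] {V : Type*} [AddCommGroup V] [Module K V]

/-- The element `v ⊗ g` of `V ⊗ K G`. -/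
def tens (v : V) (g : G) : V ⊗[K] MonoidAlgebra K G :=
  v ⊗ₜ[K] MonoidAlgebra.single g (1 : K)

/-- The component `x_g ∈ V` of `x = ∑ g, x_g ⊗ g` in `V ⊗ K G`. -/
def comp (g : G) : V ⊗[K] MonoidAlgebra K G →ₗ[K] V :=
  (TensorProduct.rid K V).toLinearMap ∘ₗ
    LinearMap.lTensor V (Finsupp.lapply g ∘ₗ (MonoidAlgebra.coeffLinearEquiv K).toLinearMap)

/-- Right multiplication by `h` on `V ⊗ K G`, i.e. `v ⊗ g ↦ v ⊗ g h`. -/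
def rightMul (h : G) : V ⊗[K] MonoidAlgebra K G →ₗ[K] V ⊗[K] MonoidAlgebra K G :=
  LinearMap.lTensor V (LinearMap.mulRight K (MonoidAlgebra.single h (1 : K)))

theorem comp_tens [DecidableEq G] (g h : G) (v : V) :
    comp g (tens (K := K) v h) = if h = g then v else 0 := by
  by_cases hg : h = g <;>
    simp [comp, tens, MonoidAlgebra.coeffLinearEquiv, hg]

theorem rightMul_tens (g h : G) (v : V) :
    rightMul h (tens (K := K) v g) = tens v (g * h) := by
  simp [rightMul, tens, MonoidAlgebra.single_mul_single]

theorem sum_tens_comp [Fintype G] (x : V ⊗[K] MonoidAlgebra K G) :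
    ∑ g, tens (comp g x) g = x := by
  classical
  induction x using TensorProduct.induction_on with
  | zero => simp [tens]
  | add x y hx hy =>
    conv_rhs => rw [← hx, ← hy]
    simp [tens, TensorProduct.add_tmul, Finset.sum_add_distrib]
  | tmul v a =>
    have h : a = ∑ g, MonoidAlgebra.single g (a.coeff g) := by
      ext k
      simp [MonoidAlgebra.coeff_sum]
    conv_rhs => rw [h, TensorProduct.tmul_sum]
    refine Finset.sum_congr rfl fun g _ => ?_
    simp [comp, tens, MonoidAlgebra.coeffLinearEquiv, TensorProduct.smul_tmul]

variable [DistribMulAction G V] [SMulCommClass G K V]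

/-- The adjoint action of `g` on `V ⊗ K G`, i.e. `v ⊗ h ↦ (g • v) ⊗ g h g⁻¹`. -/
def adjoint (g : G) : V ⊗[K] MonoidAlgebra K G →ₗ[K] V ⊗[K] MonoidAlgebra K G :=
  TensorProduct.map (DistribSMul.toLinearMap K V g)
    (MonoidAlgebra.mapDomainLinearMap K K fun h => g * h * g⁻¹)

theorem adjoint_tens (g h : G) (v : V) :
    adjoint g (tens (K := K) v h) = tens (g • v) (g * h * g⁻¹) := by
  simp [adjoint, tens]

variable [Fintype G]

/-- The extension of `κ : V × V → V ⊗ K G` to `V ⊗ K G` in both arguments, determined by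
`κ (v g, w h) = κ (v, g • w) g h`. -/
def extend (κ : V →ₗ[K] V →ₗ[K] V ⊗[K] MonoidAlgebra K G) (x y : V ⊗[K] MonoidAlgebra K G) :
    V ⊗[K] MonoidAlgebra K G :=
  ∑ g, ∑ h, rightMul (g * h) (κ (comp g x) (g • comp h y))

theorem extend_tens (κ : V →ₗ[K] V →ₗ[K] V ⊗[K] MonoidAlgebra K G) (v w : V) (g h : G) :
    extend κ (tens v g) (tens w h) = rightMul (g * h) (κ v (g • w)) := by
  classical
  rw [extend, Finset.sum_eq_single g, Finset.sum_eq_single h]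
  · simp [comp_tens]
  · intro b _ hb
    simp [comp_tens, hb.symm]
  · simp
  · intro b _ hb
    simp [comp_tens, hb.symm]
  · simp

/-- The canonical inclusion `V ⊗ K G → T(V) ⋊ G`, `v ⊗ g ↦ v g`. -/
def toSkew (x : V ⊗[K] MonoidAlgebra K G) : SkewTensor K G V :=
  ∑ g, SkewMonoidAlgebra.single g (TensorAlgebra.ι K (comp g x))

theorem toSkew_tens (v : V) (g : G) :
    toSkew (tens (K := K) v g) = SkewMonoidAlgebra.single g (TensorAlgebra.ι K v) := by
  classical
  rw [toSkew, Finset.sum_eq_single g]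
  · simp [comp_tens]
  · intro b _ hb
    simp [comp_tens, hb.symm]
  · simp

end Bimodule

/-! ### Quantum scalars, parameter functions and the algebra `H_{q,κ}` -/

/-- A quantum system of parameters: nonzero scalars with `q_ii = 1` and `q_ji = q_ij⁻¹`. -/
structure IsQuantumSystem {K : Type*} [Field K] {n : ℕ} (q : Fin n → Fin n → K) : Prop where
  ne_zero : ∀ i j, q i j ≠ 0
  diag : ∀ i, q i i = 1
  inv : ∀ i j, q j i = (q i j)⁻¹

/-- The cyclic sum `f i j k + f j k i + f k i j`. -/
def cyc {ι M : Type*} [AddCommMonoid M] (f : ι → ι → ι → M) (i j k : ι) : M :=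
  f i j k + f j k i + f k i j

section Parameter

variable {K : Type*} [Field K] {G : Type*} [Group G] {V : Type*} [AddCommGroup V] [Module K V]
  {n : ℕ} (b : Module.Basis (Fin n) K V) (q : Fin n → Fin n → K)
  (κ : V →ₗ[K] V →ₗ[K] V ⊗[K] MonoidAlgebra K G)

/-- `κ` is quantum antisymmetric: `κ (v_i, v_j) = - q_ij κ (v_j, v_i)`. -/
def QuantumAntisymmetric : Prop :=
  ∀ i j, κ (b i) (b j) = -(q i j • κ (b j) (b i))

/-- The coefficient `c_r^{ijg}` of `v_r ⊗ g` in `κ (v_i, v_j)`. -/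
def coef (i j : Fin n) (g : G) (r : Fin n) : K :=
  b.repr (comp g (κ (b i) (b j))) r

variable [DistribMulAction G V] [SMulCommClass G K V]

/-- `κ` is `G`-invariant for the given action on `V` and the adjoint action on `V ⊗ K G`. -/
def Invariant : Prop :=
  ∀ (g : G) (v w : V), κ (g • v) (g • w) = adjoint g (κ v w)

/-- The vanishing condition: for all `g`, all distinct `i, j, k` and all `r`, if the coefficient of
`v_r ⊗ g` in `κ (v_i, v_j)` is nonzero, then `g • v_k = q_ik q_jk q_kr v_k`. -/
def Vanishing : Prop :=
  ∀ (g : G) (i j k r : Fin n), i ≠ j → j ≠ k → i ≠ k → coef b κ i j g r ≠ 0 →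
    g • b k = (q i k * q j k * q k r) • b k

variable [Fintype G]

/-- The quantum Jacobi identity `0 = ∑_cyc q_jk κ (v_k, κ (v_i, v_j))` for distinct `i, j, k`. -/
def QuantumJacobi : Prop :=
  ∀ i j k : Fin n, i ≠ j → j ≠ k → i ≠ k →
    cyc (fun i j k => q j k • extend κ (tens (b k) 1) (κ (b i) (b j))) i j k = 0

/-- The defining relations `v_i v_j = q_ij v_j v_i + κ (v_i, v_j)` in `T(V) ⋊ G`. -/
inductive Rel : SkewTensor K G V → SkewTensor K G V → Prop
  | relation (i j : Fin n) :
      Rel (SkewMonoidAlgebra.single 1 (TensorAlgebra.ι K (b i) * TensorAlgebra.ι K (b j)))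
        (q i j • SkewMonoidAlgebra.single 1 (TensorAlgebra.ι K (b j) * TensorAlgebra.ι K (b i))
          + toSkew (κ (b i) (b j)))

/-- The algebra `H_{q,κ}`, the quotient of `T(V) ⋊ G` by the two-sided ideal generated by the
elements `v_i v_j - q_ij v_j v_i - κ (v_i, v_j)`. -/
abbrev H : Type _ := RingQuot (Rel b q κ)

/-- The image in `H_{q,κ}` of `v_1^{m_1} ⋯ v_n^{m_n} g` (the factors in this order). -/
def monomial (p : (Fin n → ℕ) × G) : H b q κ :=
  RingQuot.mkAlgHom K (Rel b q κ)
    (SkewMonoidAlgebra.single p.2 (List.ofFn fun i => TensorAlgebra.ι K (b i) ^ p.1 i).prod)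

/-- The PBW property: the elements `v_1^{m_1} ⋯ v_n^{m_n} g`, for `m ∈ ℕ^n` and `g ∈ G`, form a
`K`-basis of `H_{q,κ}`. -/
def PBW : Prop :=
  LinearIndependent K (monomial b q κ) ∧ Submodule.span K (Set.range (monomial b q κ)) = ⊤

end Parameter

/-! ### The three PBW conditions; the first one is `Invariant` -/

section Conditions

variable {K : Type*} [Field K] {G : Type*} [Group G] {V : Type*} [AddCommGroup V] [Module K V]
  {n : ℕ} (b : Module.Basis (Fin n) K V) (χ : Fin n → G →* Kˣ) (q : Fin n → Fin n → K)
  (κ : V →ₗ[K] V →ₗ[K] V ⊗[K] MonoidAlgebra K G)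

/-- The second PBW condition: for all `g` and all distinct `i, j, k`,
`0 = (χ_k(g) - q_jk q_ik q_kr) c_r^{ijg}` for every `r ≠ i, j`, and
`0 = (1 - q_ij χ_i(g)) c_k^{jkg} + (q_jk - χ_k(g)) c_i^{ijg}`. -/
def PBWCondition₂ : Prop :=
  ∀ (g : G) (i j k : Fin n), i ≠ j → j ≠ k → i ≠ k →
    (∀ r, r ≠ i → r ≠ j →
      0 = ((χ k g : K) - q j k * q i k * q k r) * coef b κ i j g r) ∧
    0 = (1 - q i j * (χ i g : K)) * coef b κ j k g k + (q j k - (χ k g : K)) * coef b κ i j g i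

/-- The third PBW condition, as an identity in `V ⊗ K G`:
`0 = ∑_g (∑_cyc (χ_k(g) - q_jk) c_i^{ijg} κ (v_k, v_i) + ∑_cyc q_jk κ (v_k, κ_g (v_i, v_j))) g`
for distinct `i, j, k`. -/
def PBWCondition₃ [Fintype G] : Prop :=
  ∀ i j k : Fin n, i ≠ j → j ≠ k → i ≠ k →
    0 = ∑ g : G, rightMul g
      (cyc (fun i j k => (((χ k g : K) - q j k) * coef b κ i j g i) • κ (b k) (b i)) i j k +
        cyc (fun i j k => q j k • κ (b k) (comp g (κ (b i) (b j)))) i j k)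

end Conditions

end

end QuantumDrinfeld

/-! The core is the equivalence of the PBW property with (1), (2), (3), which needs no assumption on
fixed points. The passage to (1'), (2'), (3') is then elementary.

Sufficiency is Bergman's diamond lemma. In `T(V) ⋊ G`, with basis the words times group elements,
each descent `v_j v_i` (`j > i`) is rewritten by its relation. Invariance lets group elements pass
through relations, so only overlaps `v_k v_j v_i` obstruct. Modulo the relations, the obstruction
(`map_overlap`) splits into quadratic terms, whose coefficients are those of (2), and a linear part,
which is the sum in (3). If both vanish, `IsParameter.exists_normalForm` gives a linear map that
kills the ideal and fixes sorted words, whence `pbw_of_overlap`.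

Necessity reads the same formula backwards. Given a PBW basis, functionals that kill the ideal can
be prescribed on sorted words. Those dual to words of length one detect (1) and (3), those dual to
words of length two detect (2).

Finally, (3) and the quantum Jacobi identity differ by terms with factors `(χ_k(g) - q_jk)
c_i^{ijg}`, and (2) and the vanishing condition differ only in how they treat `c_i^{ijg}` and
`c_j^{ijg}`. The vanishing condition kills the extra terms. For a fixed point free action,
invariance already forces these coefficients to be zero. -/

namespace QuantumDrinfeld

noncomputable section

/-! ### Linear diamond lemma and kernels of ring quotients. -/

section DiamondLemma

variable {K : Type*} [Field K] {A : Type*} [AddCommGroup A] [Module K A] {ι : Type*}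

/-- Bergman's diamond lemma for a module with a well-founded order on a basis: if every rewriting
rule `x ↦ φ` lowers the order and any two rules with the same left-hand side are resolvable, then
there is a normal form map compatible with all rules that fixes the irreducible basis vectors. -/
theorem exists_normalForm (β : Module.Basis ι K A) {lt : ι → ι → Prop} (hwf : WellFounded lt)
    (R : ι → A → Prop)
    (hlt : ∀ x φ, R x φ → φ ∈ Submodule.span K (β '' {y | lt y x}))
    (hres : ∀ x φ ψ, R x φ → R x ψ →
      φ - ψ ∈ Submodule.span K {z | ∃ y ρ, lt y x ∧ R y ρ ∧ z = β y - ρ}) :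
    ∃ N : A →ₗ[K] A, (∀ x φ, R x φ → N (β x) = N φ) ∧
      ∀ x, (∀ φ, ¬ R x φ) → N (β x) = β x := by
  classical
  -- One rule is chosen at each reducible `x`, and the normal form of its right-hand side is taken
  -- recursively. By `hlt` the guard `lt y x` always holds on the support, so the default `0` never
  -- occurs.
  let F : (x : ι) → ((y : ι) → lt y x → A) → A := fun x ih =>
    if h : ∃ φ, R x φ then
      ∑ y ∈ (β.repr h.choose).support, if hy : lt y x then β.repr h.choose y • ih y hy else 0
    else β x
  let nf : ι → A := hwf.fix F
  have hnf : ∀ x, nf x = F x fun y _ => nf y := fun x => hwf.fix_eq F x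
  let N : A →ₗ[K] A := β.constr K nf
  have hN : ∀ x, N (β x) = nf x := fun x => β.constr_basis K nf x
  have hchoice : ∀ x, (h : ∃ φ, R x φ) → N (β x) = N h.choose := by
    intro x h
    have hsupp := β.mem_span_image.1 (hlt x _ h.choose_spec)
    rw [hN, hnf]
    simp only [F, dif_pos h]
    simp only [N, Module.Basis.constr_apply]
    refine Finset.sum_congr rfl fun y hy => ?_
    have hyx : lt y x := hsupp hy
    rw [dif_pos hyx]
  refine ⟨N, fun x => ?_, fun x hx => ?_⟩
  · induction x using hwf.induction with
    | _ x ih =>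
      intro φ hφ
      have h : ∃ φ, R x φ := ⟨φ, hφ⟩
      rw [hchoice x h, ← sub_eq_zero, ← map_sub]
      -- The difference between the chosen rule and any other one is a combination of rules at
      -- smaller indices, which `N` respects by induction.
      have hle : Submodule.span K {z | ∃ y ρ, lt y x ∧ R y ρ ∧ z = β y - ρ} ≤ LinearMap.ker N := by
        rw [Submodule.span_le]
        rintro _ ⟨y, ρ, hy, hρ, rfl⟩
        simp [ih y hy ρ hρ]
      exact hle (hres x _ _ h.choose_spec hφ)
  · rw [hN, hnf]
    have h : ¬ ∃ φ, R x φ := fun ⟨φ, hφ⟩ => hx φ hφ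
    simp only [F, dif_neg h]

end DiamondLemma

/-- `S` need not be an ideal: later it is the kernel of a linear normal form map. Carrying arbitrary
factors `a`, `b` on both sides makes the induction through the generated ring congruence work. -/
theorem sub_mem_of_mkAlgHom_eq {K : Type*} [CommRing K] {A : Type*} [Ring A] [Algebra K A]
    {r : A → A → Prop} {S : Submodule K A} (hS : ∀ x y a b, r x y → a * (x - y) * b ∈ S) {x y : A}
    (h : RingQuot.mkAlgHom K r x = RingQuot.mkAlgHom K r y) : x - y ∈ S := by
  have h' : RingQuot.mkRingHom r x = RingQuot.mkRingHom r y := by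
    rw [← RingQuot.mkAlgHom_coe K r]; exact h
  simp only [RingQuot.mkRingHom_def, RingHom.coe_mk, MonoidHom.coe_mk, OneHom.coe_mk,
    RingQuot.mk.injEq] at h'
  have hrel : ∀ x y, RingQuot.Rel r x y → ∀ a b, a * (x - y) * b ∈ S := by
    intro x y hxy
    induction hxy with
    | of hr => exact fun a b => hS _ _ a b hr
    | add_left _ ih => intro a b; simpa using ih a b
    | @mul_left x y z _ ih =>
      intro a b
      simpa [← sub_mul, mul_assoc] using ih a (z * b)
    | @mul_right x y z _ ih =>
      intro a b
      simpa [← mul_sub, mul_assoc] using ih (a * x) b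
  have hgen : ∀ x y, Relation.EqvGen (RingQuot.Rel r) x y → x - y ∈ S := by
    intro x y hxy
    induction hxy with
    | rel x y hr => simpa using hrel x y hr 1 1
    | refl x => simp
    | symm x y _ ih => simpa using S.neg_mem ih
    | trans x y z _ _ h₁ h₂ => simpa using S.add_mem h₁ h₂
  exact hgen x y (Quot.eqvGen_exact h')

theorem IsQuantumSystem.mul_swap {K : Type*} [Field K] {n : ℕ} {q : Fin n → Fin n → K}
    (hq : IsQuantumSystem q) (i j : Fin n) : q i j * q j i = 1 := by
  rw [hq.inv i j, mul_inv_cancel₀ (hq.ne_zero i j)]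

/-! ### Quantum relations in an arbitrary algebra -/

section Relations

variable {K : Type*} [Field K] {G : Type*} [CommGroup G] {n : ℕ} {A : Type*} [Ring A] [Algebra K A]
  (χ : Fin n → G →* Kˣ) (q : Fin n → Fin n → K) (c : Fin n → Fin n → G → Fin n → K)
  (X : Fin n → A) (γ : G →* A)

/-- The product of the generators `X i` along a word. -/
def word (w : List (Fin n)) : A := (w.map X).prod

@[simp] theorem word_nil : word X [] = 1 := rfl

@[simp] theorem word_cons (i : Fin n) (w : List (Fin n)) : word X (i :: w) = X i * word X w := by
  simp [word]

@[simp] theorem word_append (u w : List (Fin n)) : word X (u ++ w) = word X u * word X w := by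
  simp [word]

/-- The group-like generators `γ g` commute with the `X i` up to the characters `χ i`. -/
def SkewCommutes : Prop := ∀ (g : G) (i : Fin n), γ g * X i = (χ i g : K) • (X i * γ g)

variable {χ X γ} in
theorem SkewCommutes.mul_word (h : SkewCommutes χ X γ) (g : G) (w : List (Fin n)) :
    ∃ s : K, γ g * word X w = s • (word X w * γ g) := by
  induction w with
  | nil => exact ⟨1, by simp⟩
  | cons i w ih =>
    obtain ⟨s, hs⟩ := ih
    refine ⟨χ i g * s, ?_⟩
    rw [word_cons, ← mul_assoc, h g i, smul_mul_assoc, mul_assoc, hs]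
    simp [smul_smul, mul_assoc]

theorem map_mul_map_comm (g h : G) : γ g * γ h = γ h * γ g := by
  rw [← map_mul, mul_comm, map_mul]

variable [Fintype G]

/-- The element `∑ c_r^{ijg} X_r γ_g`. -/
def kap (i j : Fin n) : A := ∑ g, ∑ r, c i j g r • (X r * γ g)

/-- The element `X_i X_j - q_ij X_j X_i - ∑ c_r^{ijg} X_r γ_g`. -/
def rel (i j : Fin n) : A := X i * X j - q i j • (X j * X i) - kap c X γ i j

/-- The obstruction attached to the overlap `X_k X_j X_i`. -/
def overlap (i j k : Fin n) : A :=
  cyc (fun i j k => q j k • (X k * kap c X γ i j) - q k i • (kap c X γ i j * X k)) i j k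

/-- The cubic monomials cancel in the cyclic sum, so the obstruction lies in the ideal of relations,
although it is written purely in terms of `kap`. -/
theorem overlap_eq (i j k : Fin n) :
    overlap q c X γ i j k = -cyc (fun i j k => q j k • (X k * rel q c X γ i j) -
      q k i • (rel q c X γ i j * X k)) i j k := by
  simp only [overlap, cyc, rel, mul_sub, sub_mul, smul_sub, mul_smul_comm, smul_mul_assoc,
    smul_smul, mul_assoc]
  module

/-- The coefficient of `X_k X_i γ_g` in the quadratic part of the obstruction. -/
def diagCoef (i j k : Fin n) (g : G) : K :=
  (1 - q i j * (χ i g : K)) * c j k g k + (q j k - (χ k g : K)) * c i j g i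

/-- The linear part at `g` of the obstruction. -/
def linearPart (i j k : Fin n) (g : G) : A :=
  cyc (fun i j k => (((χ k g : K) - q j k) * c i j g i) • kap c X γ k i) i j k +
    cyc (fun i j k => q j k • ∑ r, c i j g r • kap c X γ k r) i j k

variable {χ X γ} in
-- Conjugation by `γ t` scales the quadratic part of a relation. What remains is the failure of
-- invariance of the parameter, now seen to lie in the ideal.
theorem SkewCommutes.conj_rel (hX : SkewCommutes χ X γ) (i j : Fin n) (t : G) :
    γ t * rel q c X γ i j * γ t⁻¹ - ((χ i t : K) * χ j t) • rel q c X γ i j =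
      ((χ i t : K) * χ j t) • kap c X γ i j - γ t * kap c X γ i j * γ t⁻¹ := by
  have hm : ∀ i j, γ t * (X i * X j) * γ t⁻¹ = ((χ i t : K) * χ j t) • (X i * X j) := by
    intro i j
    rw [← mul_assoc, hX t i, smul_mul_assoc, mul_assoc, hX t j, mul_smul_comm, smul_smul,
      smul_mul_assoc, mul_assoc, mul_assoc, ← map_mul, mul_inv_cancel, map_one, mul_one]
  simp only [rel, mul_sub, sub_mul, mul_smul_comm, smul_mul_assoc, hm]
  module

variable {χ q X γ} {M : Type*} [AddCommGroup M] [Module K M]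

theorem map_mul_mul_of_rel {f : A →ₗ[K] M} (hf : ∀ i j g, f (rel q c X γ i j * γ g) = 0)
    (i j : Fin n) (g : G) :
    f (X i * X j * γ g) = q i j • f (X j * X i * γ g) + f (kap c X γ i j * γ g) := by
  rw [← sub_eq_zero, ← hf i j g]
  simp only [rel, sub_mul, map_sub, smul_mul_assoc, map_smul]
  abel

theorem sum_eq_add_add_sum {M : Type*} [AddCommMonoid M] {i j : Fin n} (hij : i ≠ j)
    (F : Fin n → M) :
    ∑ r, F r = F i + F j + ∑ r with r ≠ i ∧ r ≠ j, F r := by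
  rw [← Finset.add_sum_erase _ _ (Finset.mem_univ i),
    ← Finset.add_sum_erase _ _ (Finset.mem_erase.2 ⟨hij.symm, Finset.mem_univ j⟩), add_assoc]
  congr 2
  refine Finset.sum_congr ?_ fun _ _ => rfl
  ext r
  simp [and_comm]

theorem overlap_term (hX : SkewCommutes χ X γ) (i j k : Fin n) :
    q j k • (X k * kap c X γ i j) - q k i • (kap c X γ i j * X k) =
      ∑ g, ∑ r, c i j g r •
        (q j k • (X k * X r * γ g) - (q k i * (χ k g : K)) • (X r * X k * γ g)) := by
  simp only [kap, Finset.mul_sum, Finset.sum_mul, Finset.smul_sum, ← Finset.sum_sub_distrib]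
  refine Finset.sum_congr rfl fun g _ => Finset.sum_congr rfl fun r _ => ?_
  rw [smul_mul_assoc, mul_assoc (X r), hX g k]
  simp only [mul_smul_comm, smul_sub, smul_smul, mul_assoc]
  congr 2 <;> ring

/-- For `r ≠ i, j` the product `X_k X_r` is reordered to `X_r X_k`. The term `r = i` is instead kept
as `X_k X_i`, and turning `X_i X_k` back costs the correction `(χ_k(g) - q_jk) c_i^{ijg} κ(v_k,
v_i)` of condition (3). In the cyclic sum the `r = i` and `r = j` monomials of consecutive terms
coincide and combine into `diagCoef`. -/
theorem map_overlap_term (hq : IsQuantumSystem q) {f : A →ₗ[K] M}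
    (hf : ∀ i j g, f (rel q c X γ i j * γ g) = 0) {i j k : Fin n} (hij : i ≠ j) (g : G) :
    f (∑ r, c i j g r •
        (q j k • (X k * X r * γ g) - (q k i * (χ k g : K)) • (X r * X k * γ g))) =
      ∑ r with r ≠ i ∧ r ≠ j,
          (c i j g r * (q j k * q k r - q k i * (χ k g : K))) • f (X r * X k * γ g) +
        ((q j k - (χ k g : K)) * c i j g i) • f (X k * X i * γ g) +
        ((1 - q k i * (χ k g : K)) * c i j g j) • f (X j * X k * γ g) +
        (((χ k g : K) - q j k) * c i j g i) • f (kap c X γ k i * γ g) +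
        q j k • ∑ r, c i j g r • f (kap c X γ k r * γ g) := by
  have hjk : q j k * q k j = 1 := hq.mul_swap j k
  have hki := map_mul_mul_of_rel c hf k i g
  have hterm : ∀ r, f (c i j g r •
      (q j k • (X k * X r * γ g) - (q k i * (χ k g : K)) • (X r * X k * γ g))) =
      (c i j g r * (q j k * q k r - q k i * (χ k g : K))) • f (X r * X k * γ g) +
        q j k • c i j g r • f (kap c X γ k r * γ g) := by
    intro r
    simp only [map_sub, map_smul, map_mul_mul_of_rel c hf k r g]
    module
  rw [map_sum, Finset.sum_congr rfl fun r _ => hterm r, Finset.sum_add_distrib,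
    sum_eq_add_add_sum hij, Finset.smul_sum, hki]
  have h1 : (c i j g j * (q j k * q k j - q k i * (χ k g : K))) =
      (1 - q k i * (χ k g : K)) * c i j g j := by rw [hjk]; ring
  rw [h1]
  module

/-- Evaluation of the obstruction under a linear map that kills the defining relations. -/
theorem map_overlap (hX : SkewCommutes χ X γ) (hq : IsQuantumSystem q) {f : A →ₗ[K] M}
    (hf : ∀ i j g, f (rel q c X γ i j * γ g) = 0) {i j k : Fin n} (hij : i ≠ j) (hjk : j ≠ k)
    (hik : i ≠ k) :
    f (overlap q c X γ i j k) = ∑ g,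
      (cyc (fun i j k => ∑ r with r ≠ i ∧ r ≠ j,
          (c i j g r * (q j k * q k r - q k i * (χ k g : K))) • f (X r * X k * γ g)) i j k +
        cyc (fun i j k => diagCoef χ q c i j k g • f (X k * X i * γ g)) i j k) +
      f (∑ g, linearPart χ q c X γ i j k g * γ g) := by
  simp only [overlap, overlap_term c hX, cyc, ← Finset.sum_add_distrib]
  rw [map_sum f, map_sum f, ← Finset.sum_add_distrib]
  refine Finset.sum_congr rfl fun g _ => ?_
  rw [Finset.sum_add_distrib, Finset.sum_add_distrib, map_add, map_add, map_overlap_term c hq hf hij,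
    map_overlap_term c hq hf hjk, map_overlap_term c hq hf hik.symm]
  simp only [linearPart, cyc, diagCoef, add_mul, smul_mul_assoc, Finset.sum_mul, map_add, map_smul,
    map_sum, Finset.smul_sum, add_smul]
  abel

end Relations

/-! ### Resolving ambiguities, and normal forms. -/

section Resolution

variable {K : Type*} [Field K] {G : Type*} [CommGroup G] [Fintype G] {n : ℕ}
  {A : Type*} [Ring A] [Algebra K A]

/-- Structure constants of a quantum antisymmetric, invariant parameter function. -/
structure IsParameter (χ : Fin n → G →* Kˣ) (q : Fin n → Fin n → K)
    (c : Fin n → Fin n → G → Fin n → K) : Prop where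
  antisymm : ∀ i j g r, c i j g r = -(q i j * c j i g r)
  invariant : ∀ i j g r h, ((χ i h : K) * χ j h) * c i j g r = χ r h * c i j g r

variable {χ : Fin n → G →* Kˣ} {q : Fin n → Fin n → K} {c : Fin n → Fin n → G → Fin n → K}
  {X : Fin n → A} {γ : G →* A}

theorem IsParameter.kap_swap (hc : IsParameter χ q c) (i j : Fin n) :
    kap c X γ i j = -(q i j • kap c X γ j i) := by
  simp only [kap, Finset.smul_sum, ← Finset.sum_neg_distrib]
  refine Finset.sum_congr rfl fun g _ => Finset.sum_congr rfl fun r _ => ?_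
  rw [hc.antisymm i j g r, smul_smul, neg_smul]

/-- This is why relations with descending leading word suffice as rewriting rules. -/
theorem IsParameter.rel_swap (hc : IsParameter χ q c) (hq : IsQuantumSystem q) (i j : Fin n) :
    rel q c X γ i j = -(q i j • rel q c X γ j i) := by
  have h : q i j * q j i = 1 := hq.mul_swap i j
  rw [rel, rel, hc.kap_swap i j, smul_sub, smul_sub, smul_smul, h]
  module

/-- As `q_ii = 1`, antisymmetry makes `κ(v_i, v_i)` its own negative; the characteristic enters
through the invertibility of `2`. -/
theorem IsParameter.rel_self [CharZero K] (hc : IsParameter χ q c) (hq : IsQuantumSystem q)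
    (i : Fin n) : rel q c X γ i i = 0 := by
  have h := hc.kap_swap (X := X) (γ := γ) i i
  rw [hq.diag, one_smul] at h
  have h2 : (2 : K) • kap c X γ i i = 0 := by
    rw [two_smul]; nth_rewrite 1 [h]; simp
  have h0 := (smul_eq_zero.1 h2).resolve_left two_ne_zero
  simp [rel, hq.diag, h0]

theorem IsParameter.mul_kap (hc : IsParameter χ q c) (hX : SkewCommutes χ X γ) (h : G)
    (i j : Fin n) : γ h * kap c X γ i j = ((χ i h : K) * χ j h) • (kap c X γ i j * γ h) := by
  simp only [kap, Finset.mul_sum, Finset.sum_mul, Finset.smul_sum]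
  refine Finset.sum_congr rfl fun g _ => Finset.sum_congr rfl fun r _ => ?_
  rw [mul_smul_comm, ← mul_assoc, hX h r, smul_mul_assoc, smul_mul_assoc, smul_smul, smul_smul,
    hc.invariant, mul_assoc, mul_assoc, map_mul_map_comm γ h g, mul_comm]

/-- The quadratic part scales by `χ_i χ_j`; invariance is what makes `kap` scale by the same factor.
-/
theorem IsParameter.mul_rel (hc : IsParameter χ q c) (hX : SkewCommutes χ X γ) (h : G)
    (i j : Fin n) : γ h * rel q c X γ i j = ((χ i h : K) * χ j h) • (rel q c X γ i j * γ h) := by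
  have hm : ∀ i j, γ h * (X i * X j) = ((χ i h : K) * χ j h) • (X i * X j * γ h) := by
    intro i j
    rw [← mul_assoc, hX h i, smul_mul_assoc, mul_assoc, hX h j, mul_smul_comm, smul_smul,
      mul_assoc]
  simp only [rel, mul_sub, sub_mul, mul_smul_comm, smul_mul_assoc, hm, hc.mul_kap hX]
  module

variable (q c X γ) in
/-- A defining relation multiplied by words and a group element. -/
def relTerm (u : List (Fin n)) (i j : Fin n) (t : List (Fin n)) (g : G) : A :=
  word X u * rel q c X γ i j * word X t * γ g

/-- Since relations are semi-invariant, group elements can be collected on the right. The scalar is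
irrelevant because only span membership is used. -/
theorem IsParameter.mul_relTerm (hc : IsParameter χ q c) (hX : SkewCommutes χ X γ) (h : G)
    (u : List (Fin n)) (i j : Fin n) (t : List (Fin n)) (g : G) :
    ∃ s : K, γ h * relTerm q c X γ u i j t g = s • relTerm q c X γ u i j t (h * g) := by
  obtain ⟨s, hs⟩ := hX.mul_word h u
  obtain ⟨s', hs'⟩ := hX.mul_word h t
  refine ⟨s * (((χ i h : K) * χ j h) * s'), ?_⟩
  calc γ h * relTerm q c X γ u i j t g
      = γ h * word X u * rel q c X γ i j * word X t * γ g := by simp [relTerm, mul_assoc]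
    _ = s • (word X u * (γ h * rel q c X γ i j) * word X t * γ g) := by
        rw [hs]; simp [mul_assoc]
    _ = (s * ((χ i h : K) * χ j h)) •
          (word X u * rel q c X γ i j * (γ h * word X t) * γ g) := by
        rw [hc.mul_rel hX]; simp [mul_assoc, smul_smul]
    _ = _ := by
        rw [hs']; simp [relTerm, mul_assoc, smul_smul]

theorem relTerm_mul_word (hX : SkewCommutes χ X γ) (u : List (Fin n)) (i j : Fin n)
    (t t' : List (Fin n)) (h g : G) :
    ∃ s : K, relTerm q c X γ u i j t h * (word X t' * γ g) =
      s • relTerm q c X γ u i j (t ++ t') (h * g) := by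
  obtain ⟨s, hs⟩ := hX.mul_word h t'
  refine ⟨s, ?_⟩
  calc relTerm q c X γ u i j t h * (word X t' * γ g)
      = word X u * rel q c X γ i j * word X t * (γ h * word X t') * γ g := by
        simp [relTerm, mul_assoc]
    _ = _ := by rw [hs]; simp [relTerm, mul_assoc]

variable (q c X γ) in
/-- The span of the relations whose leading word is smaller than `w`. -/
def relSpan (w : List (Fin n)) : Submodule K A :=
  Submodule.span K {z | ∃ u j i t g, i < j ∧ List.Shortlex (· < ·) (u ++ j :: i :: t) w ∧
    z = relTerm q c X γ u j i t g}

theorem relTerm_mem {u t w : List (Fin n)} {i j : Fin n} (hij : i < j)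
    (h : List.Shortlex (· < ·) (u ++ j :: i :: t) w) (g : G) :
    relTerm q c X γ u j i t g ∈ relSpan q c X γ w :=
  Submodule.subset_span ⟨u, j, i, t, g, hij, h, rfl⟩

/-- For strictly shorter words shortlex ignores the letters, so the order of `i` and `j` is
immaterial. This absorbs all terms in which `kap` has replaced two letters by one. -/
theorem IsParameter.relTerm_mem_of_length [CharZero K] (hc : IsParameter χ q c)
    (hq : IsQuantumSystem q) {u t w : List (Fin n)} (i j : Fin n)
    (h : u.length + t.length + 2 < w.length) (g : G) :
    relTerm q c X γ u i j t g ∈ relSpan q c X γ w := by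
  have hlen : ∀ i j, List.Shortlex (· < ·) (u ++ j :: i :: t) w := fun i j =>
    List.Shortlex.of_length_lt (by simp; omega)
  rcases lt_trichotomy i j with hij | rfl | hij
  · have : relTerm q c X γ u i j t g = -(q i j • relTerm q c X γ u j i t g) := by
      rw [relTerm, hc.rel_swap hq]
      simp [relTerm]
    rw [this]
    exact Submodule.neg_mem _ (Submodule.smul_mem _ _ (relTerm_mem hij (hlen _ _) g))
  · rw [relTerm, hc.rel_self hq]
    simp
  · exact relTerm_mem hij (hlen _ _) g

theorem shortlex_swap {i j : Fin n} (hij : i < j) (u t : List (Fin n)) :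
    List.Shortlex (· < ·) (u ++ i :: j :: t) (u ++ j :: i :: t) :=
  List.Shortlex.append_left (List.Shortlex.of_lex (by simp) (List.Lex.rel hij)) u

/-- Two relations whose leading words do not meet are resolvable. -/
theorem IsParameter.disjoint_resolvable [CharZero K] (hc : IsParameter χ q c)
    (hq : IsQuantumSystem q) (hX : SkewCommutes χ X γ) {i j a b : Fin n} (hij : i < j)
    (hab : a < b) (u m t : List (Fin n)) (g : G) :
    relTerm q c X γ u j i (m ++ b :: a :: t) g - relTerm q c X γ (u ++ j :: i :: m) b a t g ∈
      relSpan q c X γ (u ++ j :: i :: (m ++ b :: a :: t)) := by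
  set S := relSpan q c X γ (u ++ j :: i :: (m ++ b :: a :: t))
  have h1 : relTerm q c X γ u j i (m ++ a :: b :: t) g ∈ S := by
    refine relTerm_mem hij ?_ g
    simpa using shortlex_swap hab (u ++ j :: i :: m) t
  have h2 : relTerm q c X γ (u ++ i :: j :: m) b a t g ∈ S := by
    refine relTerm_mem hab ?_ g
    simpa using shortlex_swap hij u (m ++ b :: a :: t)
  have h3 : relTerm q c X γ u j i m 1 * kap c X γ b a * (word X t * γ g) ∈ S := by
    simp only [kap, Finset.mul_sum, Finset.sum_mul]
    refine Submodule.sum_mem _ fun h _ => Submodule.sum_mem _ fun r _ => ?_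
    have : relTerm q c X γ u j i m 1 * (X r * γ h) = relTerm q c X γ u j i (m ++ [r]) h := by
      simp [relTerm, mul_assoc]
    rw [mul_smul_comm, smul_mul_assoc, this]
    obtain ⟨s, hs⟩ := relTerm_mul_word (q := q) (c := c) hX u j i (m ++ [r]) t h g
    rw [hs]
    refine Submodule.smul_mem _ _ (Submodule.smul_mem _ _ ?_)
    exact hc.relTerm_mem_of_length hq _ _ (by simp; omega) _
  have h4 : word X u * kap c X γ j i * relTerm q c X γ m b a t g ∈ S := by
    simp only [kap, Finset.mul_sum, Finset.sum_mul]
    refine Submodule.sum_mem _ fun h _ => Submodule.sum_mem _ fun r _ => ?_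
    obtain ⟨s, hs⟩ := hc.mul_relTerm hX h m b a t g
    have : word X u * (X r * γ h) * relTerm q c X γ m b a t g =
        s • relTerm q c X γ (u ++ r :: m) b a t (h * g) := by
      rw [mul_assoc, mul_assoc, hs]
      simp [relTerm, mul_assoc]
    rw [mul_smul_comm, smul_mul_assoc, this]
    refine Submodule.smul_mem _ _ (Submodule.smul_mem _ _ ?_)
    exact hc.relTerm_mem_of_length hq _ _ (by simp; omega) _
  -- In each term the untouched pair of letters is expanded as swapped pair plus `kap` plus
  -- relation. The product of the two relations then appears in both terms and cancels.
  have key : relTerm q c X γ u j i (m ++ b :: a :: t) g -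
      relTerm q c X γ (u ++ j :: i :: m) b a t g =
      q b a • relTerm q c X γ u j i (m ++ a :: b :: t) g +
        relTerm q c X γ u j i m 1 * kap c X γ b a * (word X t * γ g) -
        q j i • relTerm q c X γ (u ++ i :: j :: m) b a t g -
        word X u * kap c X γ j i * relTerm q c X γ m b a t g := by
    have e1 : kap c X γ b a = X b * X a - q b a • (X a * X b) - rel q c X γ b a := by
      simp [rel]
    have e2 : kap c X γ j i = X j * X i - q j i • (X i * X j) - rel q c X γ j i := by
      simp [rel]
    rw [e1, e2]
    simp only [relTerm, word_append, word_cons, map_one, mul_sub, sub_mul, mul_smul_comm,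
      smul_mul_assoc, mul_one, mul_assoc]
    abel
  rw [key]
  exact S.sub_mem (S.sub_mem (S.add_mem (S.smul_mem _ h1) h3) (S.smul_mem _ h2)) h4

/-- Two relations whose leading words overlap are resolvable if the obstruction vanishes modulo
the quadratic relations. -/
theorem IsParameter.overlap_resolvable [CharZero K] (hc : IsParameter χ q c)
    (hq : IsQuantumSystem q) (hX : SkewCommutes χ X γ) {i j k : Fin n} (hij : i < j) (hjk : j < k)
    (hΩ : overlap q c X γ i j k ∈
      Submodule.span K {z | ∃ a b g, z = rel q c X γ a b * γ g})
    (u t : List (Fin n)) (g : G) :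
    relTerm q c X γ u k j (i :: t) g - relTerm q c X γ (u ++ [k]) j i t g ∈
      relSpan q c X γ (u ++ k :: j :: i :: t) := by
  set S := relSpan q c X γ (u ++ k :: j :: i :: t)
  have hik := hij.trans hjk
  have h0 : word X u * overlap q c X γ i j k * (word X t * γ g) ∈ S := by
    -- The quadratic relations modulo which the obstruction vanishes have leading words of length
    -- two, one letter less than the overlap.
    have hle : Submodule.span K {z | ∃ a b g, z = rel q c X γ a b * γ g} ≤
        S.comap (LinearMap.mulRight K (word X t * γ g) ∘ₗ LinearMap.mulLeft K (word X u)) := by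
      rw [Submodule.span_le]
      rintro _ ⟨a, b, h, rfl⟩
      obtain ⟨s, hs⟩ := relTerm_mul_word (q := q) (c := c) hX u a b [] t h g
      have : word X u * (rel q c X γ a b * γ h) * (word X t * γ g) =
          s • relTerm q c X γ u a b ([] ++ t) (h * g) := by
        rw [← hs]; simp [relTerm, mul_assoc]
      simp only [Submodule.comap_coe, Set.mem_preimage, LinearMap.comp_apply,
        LinearMap.mulLeft_apply, LinearMap.mulRight_apply, SetLike.mem_coe, this]
      exact S.smul_mem _ (hc.relTerm_mem_of_length hq _ _ (by simp; omega) _)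
    exact hle hΩ
  have h1 : relTerm q c X γ (u ++ [i]) k j t g ∈ S := by
    refine relTerm_mem hjk ?_ g
    rw [List.append_assoc]
    exact List.Shortlex.append_left (List.Shortlex.of_lex (by simp) (List.Lex.rel hik)) u
  have h2 : relTerm q c X γ (u ++ [j]) k i t g ∈ S := by
    refine relTerm_mem hik ?_ g
    rw [List.append_assoc]
    exact List.Shortlex.append_left (List.Shortlex.of_lex (by simp) (List.Lex.rel hjk)) u
  have h3 : relTerm q c X γ u k i (j :: t) g ∈ S := by
    refine relTerm_mem hik ?_ g
    exact List.Shortlex.append_left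
      (List.Shortlex.of_lex (by simp) (List.Lex.cons (List.Lex.rel hij))) u
  have h4 : relTerm q c X γ u j i (k :: t) g ∈ S := by
    refine relTerm_mem hij ?_ g
    exact List.Shortlex.append_left (List.Shortlex.of_lex (by simp) (List.Lex.rel hjk)) u
  have hne : q i j * q j k ≠ 0 := mul_ne_zero (hq.ne_zero _ _) (hq.ne_zero _ _)
  -- Of the six products in `overlap_eq`, two form the critical pair with the common unit factor
  -- `q_ij q_jk`. The other four have leading words below `k j i`, as shown in `h1` to `h4`.
  have key : (q i j * q j k) •
      (relTerm q c X γ u k j (i :: t) g - relTerm q c X γ (u ++ [k]) j i t g) =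
      -(word X u * overlap q c X γ i j k * (word X t * γ g)) +
        (q k i * q j k) • relTerm q c X γ (u ++ [i]) k j t g -
        q i j • relTerm q c X γ (u ++ [j]) k i t g + q j k • relTerm q c X γ u k i (j :: t) g -
        (q k i * q i j) • relTerm q c X γ u j i (k :: t) g := by
    rw [overlap_eq]
    simp only [cyc, hc.rel_swap hq i j, hc.rel_swap hq j k]
    simp only [relTerm, word_append, word_cons, word_nil, mul_sub, sub_mul, mul_add, add_mul,
      mul_neg, neg_mul, mul_smul_comm, smul_mul_assoc, mul_one, mul_assoc, smul_sub, smul_neg,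
      smul_smul]
    module
  refine (S.smul_mem_iff hne).1 ?_
  rw [key]
  exact S.sub_mem (S.add_mem (S.sub_mem (S.add_mem (S.neg_mem h0) (S.smul_mem _ h1))
    (S.smul_mem _ h2)) (S.smul_mem _ h3)) (S.smul_mem _ h4)

/-- Two descents in one word coincide, share exactly one letter, or are disjoint. By symmetry the
first may be taken to start no later than the second. -/
theorem IsParameter.resolvable [CharZero K] (hc : IsParameter χ q c)
    (hq : IsQuantumSystem q) (hX : SkewCommutes χ X γ)
    (hΩ : ∀ i j k : Fin n, i ≠ j → j ≠ k → i ≠ k → overlap q c X γ i j k ∈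
      Submodule.span K {z | ∃ a b g, z = rel q c X γ a b * γ g})
    {i j a b : Fin n} (hij : i < j) (hab : a < b) {u t u' t' : List (Fin n)}
    (h : u ++ j :: i :: t = u' ++ b :: a :: t') (g : G) :
    relTerm q c X γ u j i t g - relTerm q c X γ u' b a t' g ∈
      relSpan q c X γ (u ++ j :: i :: t) := by
  have main : ∀ {i j a b : Fin n}, i < j → a < b → ∀ {u t m t' : List (Fin n)},
      j :: i :: t = m ++ b :: a :: t' →
      relTerm q c X γ u j i t g - relTerm q c X γ (u ++ m) b a t' g ∈
        relSpan q c X γ (u ++ j :: i :: t) := by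
    intro i j a b hij hab u t m t' h
    rcases m with _ | ⟨x, _ | ⟨y, m⟩⟩
    · simp only [List.nil_append, List.cons.injEq] at h
      obtain ⟨rfl, rfl, rfl⟩ := h
      simp
    · simp only [List.cons_append, List.nil_append, List.cons.injEq] at h
      obtain ⟨rfl, rfl, rfl⟩ := h
      exact hc.overlap_resolvable hq hX hab hij
        (hΩ _ _ _ hab.ne hij.ne (hab.trans hij).ne) u t' g
    · simp only [List.cons_append, List.cons.injEq] at h
      obtain ⟨rfl, rfl, rfl⟩ := h
      exact hc.disjoint_resolvable hq hX hij hab u m t' g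
  rcases List.append_eq_append_iff.1 h with ⟨m, rfl, hm⟩ | ⟨m, rfl, hm⟩
  · exact main hij hab hm
  · rw [h, ← neg_sub]
    exact Submodule.neg_mem _ (main hab hij hm)

/-- Rewriting a descent gives a word of the same length that is lexicographically smaller, plus
words shorter by one letter. -/
theorem relTerm_reduct_mem (hX : SkewCommutes χ X γ) (u t : List (Fin n)) {i j : Fin n}
    (hij : i < j) (g : G) :
    word X (u ++ j :: i :: t) * γ g - relTerm q c X γ u j i t g ∈
      Submodule.span K {z | ∃ w h, List.Shortlex (· < ·) w (u ++ j :: i :: t) ∧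
        z = word X w * γ h} := by
  set S := Submodule.span K {z | ∃ w h, List.Shortlex (· < ·) w (u ++ j :: i :: t) ∧
        z = word X w * γ h}
  have key : word X (u ++ j :: i :: t) * γ g - relTerm q c X γ u j i t g =
      q j i • (word X (u ++ i :: j :: t) * γ g) +
        word X u * kap c X γ j i * (word X t * γ g) := by
    simp only [relTerm, rel, word_append, word_cons, mul_sub, sub_mul, mul_smul_comm,
      smul_mul_assoc, mul_assoc]
    abel
  rw [key]
  refine S.add_mem (S.smul_mem _ (Submodule.subset_span ⟨_, g, shortlex_swap hij u t, rfl⟩)) ?_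
  simp only [kap, Finset.mul_sum, Finset.sum_mul]
  refine Submodule.sum_mem _ fun h _ => Submodule.sum_mem _ fun r _ => ?_
  obtain ⟨s, hs⟩ := hX.mul_word h t
  have : word X u * (X r * γ h) * (word X t * γ g) =
      s • (word X (u ++ r :: t) * γ (h * g)) := by
    calc word X u * (X r * γ h) * (word X t * γ g)
        = word X u * X r * (γ h * word X t) * γ g := by simp [mul_assoc]
      _ = _ := by rw [hs]; simp [mul_assoc]
  rw [mul_smul_comm, smul_mul_assoc, this]
  refine S.smul_mem _ (S.smul_mem _ (Submodule.subset_span ⟨_, _, ?_, rfl⟩))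
  exact List.Shortlex.of_length_lt (by simp)

theorem exists_descent_of_not_sortedLE {w : List (Fin n)} (hw : ¬ w.Pairwise (· ≤ ·)) :
    ∃ u j i t, i < j ∧ w = u ++ j :: i :: t := by
  rw [← List.isChain_iff_pairwise] at hw
  induction w with
  | nil => simp at hw
  | cons x w ih =>
    rcases w with _ | ⟨y, w⟩
    · simp at hw
    · by_cases hxy : x ≤ y
      · have : ¬ (y :: w).IsChain (· ≤ ·) := fun h => hw (by simp [hxy, h])
        obtain ⟨u, j, i, t, hij, h⟩ := ih this
        exact ⟨x :: u, j, i, t, hij, by simp [h]⟩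
      · exact ⟨[], x, y, w, not_le.1 hxy, rfl⟩

theorem not_pairwise_of_descent {u t : List (Fin n)} {i j : Fin n} (hij : i < j) :
    ¬ (u ++ j :: i :: t).Pairwise (· ≤ ·) := by
  intro h
  have := (List.pairwise_append.1 h).2.1
  simp only [List.pairwise_cons, List.mem_cons, forall_eq_or_imp] at this
  exact absurd this.1.1 (not_le.2 hij)

/-- The normal form map of the algebra presented by resolvable quantum relations. -/
theorem IsParameter.exists_normalForm [CharZero K] (hc : IsParameter χ q c)
    (hq : IsQuantumSystem q) (hX : SkewCommutes χ X γ)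
    (hΩ : ∀ i j k : Fin n, i ≠ j → j ≠ k → i ≠ k → overlap q c X γ i j k ∈
      Submodule.span K {z | ∃ a b g, z = rel q c X γ a b * γ g})
    (β : Module.Basis (List (Fin n) × G) K A) (hβ : ∀ p, β p = word X p.1 * γ p.2) :
    ∃ N : A →ₗ[K] A, (∀ x y i j, N (x * rel q c X γ i j * y) = 0) ∧
      ∀ p : List (Fin n) × G, p.1.Pairwise (· ≤ ·) → N (β p) = β p := by
  obtain ⟨N, hN, hN'⟩ := QuantumDrinfeld.exists_normalForm β
    -- Only words are compared: rewriting may change the group element arbitrarily.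
    (lt := InvImage (List.Shortlex (· < ·)) Prod.fst)
    (InvImage.wf _ (List.Shortlex.wf wellFounded_lt))
    (fun p φ => ∃ u j i t, i < j ∧ p.1 = u ++ j :: i :: t ∧
      φ = β p - relTerm q c X γ u j i t p.2)
    (by
      rintro ⟨w, g⟩ φ ⟨u, j, i, t, hij, hw, rfl⟩
      dsimp only at hw
      subst hw
      rw [hβ]
      refine Submodule.span_mono ?_ (relTerm_reduct_mem hX u t hij g)
      rintro _ ⟨w, h, hw, rfl⟩
      exact ⟨(w, h), hw, hβ _⟩)
    (by
      rintro ⟨w, g⟩ φ ψ ⟨u, j, i, t, hij, hw, rfl⟩ ⟨u', j', i', t', hij', hw', rfl⟩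
      dsimp only at hw hw'
      subst hw
      rw [sub_sub_sub_cancel_left]
      have h := hc.resolvable hq hX hΩ hij' hij hw'.symm g
      rw [← hw'] at h
      refine Submodule.span_mono ?_ h
      rintro _ ⟨u, j, i, t, h, hij, hlt, rfl⟩
      exact ⟨(u ++ j :: i :: t, h), _, hlt, ⟨u, j, i, t, hij, rfl, rfl⟩, by simp⟩)
  -- The rule replaces `β p` by `β p` minus a relation term, so compatibility of `N` with it says
  -- that `N` kills that term.
  have hrel : ∀ u j i t g, i < j → N (relTerm q c X γ u j i t g) = 0 := by
    intro u j i t g hij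
    have := hN (u ++ j :: i :: t, g) _ ⟨u, j, i, t, hij, rfl, rfl⟩
    rw [map_sub] at this
    exact sub_eq_self.1 this.symm
  have hrel' : ∀ u j i t g, N (relTerm q c X γ u j i t g) = 0 := by
    intro u i j t g
    rcases lt_trichotomy i j with hij | rfl | hij
    · have : relTerm q c X γ u i j t g = -(q i j • relTerm q c X γ u j i t g) := by
        rw [relTerm, hc.rel_swap hq]
        simp [relTerm]
      rw [this, map_neg, map_smul, hrel _ _ _ _ _ hij]
      simp
    · rw [relTerm, hc.rel_self hq]
      simp
    · exact hrel _ _ _ _ _ hij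
  refine ⟨N, fun x y i j => ?_, fun p hp => hN' p ?_⟩
  · suffices h : (N ∘ₗ LinearMap.mulRight K y) ∘ₗ LinearMap.mulRight K (rel q c X γ i j) = 0 from
      LinearMap.congr_fun h x
    refine β.ext fun ⟨u, h⟩ => ?_
    suffices h : N ∘ₗ LinearMap.mulLeft K (β (u, h) * rel q c X γ i j) = 0 from
      LinearMap.congr_fun h y
    refine β.ext fun ⟨t, g⟩ => ?_
    obtain ⟨s, hs⟩ := hc.mul_relTerm hX h [] i j t g
    have : β (u, h) * rel q c X γ i j * β (t, g) = s • relTerm q c X γ u i j t (h * g) := by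
      calc β (u, h) * rel q c X γ i j * β (t, g)
          = word X u * (γ h * relTerm q c X γ [] i j t g) := by
            rw [hβ, hβ]; simp [relTerm, mul_assoc]
        _ = _ := by rw [hs]; simp [relTerm, mul_assoc]
    simp only [LinearMap.comp_apply, LinearMap.mulLeft_apply, LinearMap.zero_apply, this, map_smul,
      hrel', smul_zero]
  · rintro φ ⟨u, j, i, t, hij, hw, rfl⟩
    rw [hw] at hp
    exact not_pairwise_of_descent hij hp

/-- Modulo the quantum relations, every element is a combination of sorted words. -/
theorem word_mul_mem_of_sorted (hX : SkewCommutes χ X γ) (S : Submodule K A)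
    (hrel : ∀ x y i j, x * rel q c X γ i j * y ∈ S)
    (hS : ∀ (w : List (Fin n)) (g : G), w.Pairwise (· ≤ ·) → word X w * γ g ∈ S)
    (w : List (Fin n)) (g : G) : word X w * γ g ∈ S := by
  induction w using (List.Shortlex.wf (wellFounded_lt (α := Fin n))).induction generalizing g with
  | _ w ih =>
    by_cases hw : w.Pairwise (· ≤ ·)
    · exact hS w g hw
    · obtain ⟨u, j, i, t, hij, rfl⟩ := exists_descent_of_not_sortedLE hw
      have hle : Submodule.span K {z | ∃ w h, List.Shortlex (· < ·) w (u ++ j :: i :: t) ∧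
        z = word X w * γ h} ≤ S := by
        rw [Submodule.span_le]
        rintro _ ⟨w, h, hw, rfl⟩
        exact ih w hw h
      have h := hle (relTerm_reduct_mem (q := q) (c := c) hX u t hij g)
      refine (S.sub_mem_iff_left ?_).1 h
      rw [relTerm, mul_assoc _ (word X t)]
      exact hrel _ _ _ _

end Resolution

/-! ### Sorted words and exponents -/

section NormalWord

variable {n : ℕ}

/-- The sorted word in which the letter `i` occurs `m i` times. -/
def normalWord (m : Fin n → ℕ) : List (Fin n) :=
  (List.finRange n).flatMap fun i => List.replicate (m i) i

theorem count_normalWord (m : Fin n → ℕ) (i : Fin n) : (normalWord m).count i = m i := by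
  rw [normalWord, List.count_flatMap]
  have : (List.count i ∘ fun j => List.replicate (m j) j) = fun j => if j = i then m i else 0 := by
    funext j
    by_cases h : j = i
    · subst h; simp
    · simp [List.count_replicate, h]
  rw [this, ← List.ofFn_eq_map, List.sum_ofFn]
  simp

theorem pairwise_normalWord (m : Fin n → ℕ) : (normalWord m).Pairwise (· ≤ ·) := by
  rw [normalWord, List.pairwise_flatMap]
  refine ⟨fun i _ => by simp [List.pairwise_replicate], ?_⟩
  refine (List.pairwise_lt_finRange n).imp fun {i j} hij x hx y hy => ?_
  rw [List.eq_of_mem_replicate hx, List.eq_of_mem_replicate hy]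
  exact hij.le

theorem normalWord_injective : Function.Injective (normalWord (n := n)) := fun m m' h => by
  funext i
  rw [← count_normalWord m i, h, count_normalWord]

/-- Sorted lists with equal letter counts are permutations of each other, hence equal; so exponent
vectors parametrize the sorted words. -/
theorem normalWord_count {w : List (Fin n)} (hw : w.Pairwise (· ≤ ·)) :
    normalWord (fun i => w.count i) = w :=
  List.Perm.eq_of_pairwise' (r := (· ≤ ·)) (pairwise_normalWord _) hw
    (List.perm_iff_count.2 fun i => count_normalWord _ i)

theorem word_normalWord {A : Type*} [Ring A] (X : Fin n → A) (m : Fin n → ℕ) :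
    word X (normalWord m) = (List.ofFn fun i => X i ^ m i).prod := by
  rw [List.ofFn_eq_map, normalWord]
  induction List.finRange n with
  | nil => simp
  | cons i l ih => rw [List.flatMap_cons, word_append, ih]; simp [word]

end NormalWord

/-! ### Coordinates of parameter functions -/

section Coordinates

variable {K : Type*} [Field K] {G : Type*} [CommGroup G] [Fintype G] {V : Type*} [AddCommGroup V]
  [Module K V]

theorem ext_comp {x y : V ⊗[K] MonoidAlgebra K G} (h : ∀ g, comp g x = comp g y) : x = y := by
  rw [← sum_tens_comp x, ← sum_tens_comp y]
  exact Finset.sum_congr rfl fun g _ => by rw [h]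

variable [DistribMulAction G V] [SMulCommClass G K V]

/-- Commutativity of `G` enters here: conjugation fixes the group component. -/
theorem comp_adjoint (g h : G) (x : V ⊗[K] MonoidAlgebra K G) :
    comp g (adjoint h x) = h • comp g x := by
  classical
  conv_lhs => rw [← sum_tens_comp x]
  simp only [map_sum, adjoint_tens, mul_comm h, mul_inv_cancel_right, comp_tens]
  simp

variable {n : ℕ} (b : Module.Basis (Fin n) K V) {χ : Fin n → G →* Kˣ} {q : Fin n → Fin n → K}
  {κ : V →ₗ[K] V →ₗ[K] V ⊗[K] MonoidAlgebra K G}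

theorem repr_smul (hχ : ∀ (g : G) (i : Fin n), g • b i = (χ i g : K) • b i) (g : G) (v : V)
    (r : Fin n) : b.repr (g • v) r = χ r g * b.repr v r := by
  conv_lhs => rw [← b.sum_repr v]
  simp only [Finset.smul_sum, smul_comm g, hχ, map_sum, map_smul, Finsupp.coe_finsetSum,
    Finset.sum_apply, Finsupp.smul_apply, b.repr_self, smul_eq_mul]
  rw [Finset.sum_eq_single r]
  · simp [mul_comm]
  · intro j _ hj
    simp [hj]
  · simp

/-- With a diagonal action and trivial conjugation, invariance decouples into one scalar equation
per structure constant. -/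
theorem invariant_iff (hχ : ∀ (g : G) (i : Fin n), g • b i = (χ i g : K) • b i) :
    Invariant κ ↔ ∀ i j g r h,
      ((χ i h : K) * χ j h) * coef b κ i j g r = χ r h * coef b κ i j g r := by
  have key : ∀ i j g r h, b.repr (comp g (κ (h • b i) (h • b j))) r =
      ((χ i h : K) * χ j h) * coef b κ i j g r := by
    intro i j g r h
    simp [hχ, coef, mul_assoc, mul_left_comm]
  have key' : ∀ i j g r h, b.repr (comp g (adjoint h (κ (b i) (b j)))) r =
      χ r h * coef b κ i j g r := by
    intro i j g r h
    rw [comp_adjoint, repr_smul b hχ, coef]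
  constructor
  · intro H i j g r h
    rw [← key, ← key', H]
  · intro H h v w
    have : (κ.comp (DistribSMul.toLinearMap K V h)).compl₂ (DistribSMul.toLinearMap K V h) =
        κ.compr₂ (adjoint h) := by
      refine b.ext fun i => b.ext fun j => ext_comp fun g => b.repr.injective (Finsupp.ext fun r => ?_)
      simpa [key, key'] using H i j g r h
    exact LinearMap.congr_fun₂ this v w

theorem isParameter (hχ : ∀ (g : G) (i : Fin n), g • b i = (χ i g : K) • b i)
    (hκ : QuantumAntisymmetric b q κ) (hinv : Invariant κ) : IsParameter χ q (coef b κ) where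
  antisymm i j g r := by simp [coef, hκ i j]
  invariant := (invariant_iff b hχ).1 hinv

end Coordinates

/-! ### Generators of `T(V) ⋊ G` and of `H_{q,κ}` -/

section Generators

variable {K : Type*} [Field K] {G : Type*} [CommGroup G] {V : Type*} [AddCommGroup V]
  [Module K V] [DistribMulAction G V] [SMulCommClass G K V] {n : ℕ}

/-- The generator `v_i` of `T(V) ⋊ G`. -/
def gen (b : Module.Basis (Fin n) K V) (i : Fin n) : SkewTensor K G V :=
  SkewMonoidAlgebra.single 1 (TensorAlgebra.ι K (b i))

variable (K G V) in
/-- The inclusion of `G` into `T(V) ⋊ G`. -/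
def grp : G →* SkewTensor K G V := SkewMonoidAlgebra.of (TensorAlgebra K V) G

variable (b : Module.Basis (Fin n) K V)

theorem single_mul_grp (x : TensorAlgebra K V) (g : G) :
    SkewMonoidAlgebra.single 1 x * grp K G V g = SkewMonoidAlgebra.single g x := by
  rw [grp, SkewMonoidAlgebra.of_apply, SkewMonoidAlgebra.single_mul_single, smul_one, mul_one,
    one_mul]

theorem single_one_mul_single_one (x y : TensorAlgebra K V) :
    SkewMonoidAlgebra.single (1 : G) x * SkewMonoidAlgebra.single 1 y =
      SkewMonoidAlgebra.single 1 (x * y) := by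
  rw [SkewMonoidAlgebra.single_mul_single, one_smul, mul_one]

theorem word_gen (w : List (Fin n)) :
    word (gen (G := G) b) w =
      SkewMonoidAlgebra.single 1 (word (fun i => TensorAlgebra.ι K (b i)) w) := by
  induction w with
  | nil => rfl
  | cons i w ih => rw [word_cons, word_cons, ih, gen, single_one_mul_single_one]

theorem skewCommutes {χ : Fin n → G →* Kˣ}
    (hχ : ∀ (g : G) (i : Fin n), g • b i = (χ i g : K) • b i) :
    SkewCommutes χ (gen b) (grp K G V) := by
  intro g i
  rw [gen, single_mul_grp, grp, SkewMonoidAlgebra.of_apply, SkewMonoidAlgebra.single_mul_single,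
    smul_tensor_ι, hχ, one_mul, mul_one, map_smul, SkewMonoidAlgebra.smul_single]

/-- The words in the `v_i` form a basis of `T(V)`, and `T(V) ⋊ G` is free over `T(V)` on `G`. -/
theorem exists_skewBasis : ∃ β : Module.Basis (List (Fin n) × G) K (SkewTensor K G V),
    ∀ p, β p = word (gen b) p.1 * grp K G V p.2 := by
  let β₀ : Module.Basis (Σ _ : G, FreeMonoid (Fin n)) K (SkewTensor K G V) :=
    (Finsupp.basis fun _ : G => b.tensorAlgebra).map
      (SkewMonoidAlgebra.coeffLinearEquiv (S := K) (k := TensorAlgebra K V) (G := G)).symm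
  let e : (Σ _ : G, FreeMonoid (Fin n)) ≃ List (Fin n) × G :=
    (Equiv.sigmaEquivProd G (FreeMonoid (Fin n))).trans (Equiv.prodComm _ _)
  refine ⟨β₀.reindex e, fun p => ?_⟩
  have hw : ∀ w : List (Fin n), b.tensorAlgebra (FreeMonoid.ofList w) =
      word (fun i => TensorAlgebra.ι K (b i)) w := by
    intro w
    rw [Module.Basis.tensorAlgebra, Module.Basis.map_apply, FreeAlgebra.basisFreeMonoid,
      Module.Basis.map_apply]
    simp [FreeAlgebra.equivMonoidAlgebraFreeMonoid, MonoidAlgebra.coeffLinearEquiv, word,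
      FreeMonoid.lift_apply, map_list_prod, Function.comp_def]
  rw [word_gen, single_mul_grp, ← hw]
  simp [β₀, e, Finsupp.coe_basis, SkewMonoidAlgebra.coeffLinearEquiv]
  rfl

variable [Fintype G] (q : Fin n → Fin n → K) (κ : V →ₗ[K] V →ₗ[K] V ⊗[K] MonoidAlgebra K G)

theorem toSkew_eq (x : V ⊗[K] MonoidAlgebra K G) :
    toSkew x = ∑ g, ∑ r, b.repr (comp g x) r • (gen b r * grp K G V g) := by
  rw [toSkew]
  refine Finset.sum_congr rfl fun g _ => ?_
  conv_lhs => rw [← b.sum_repr (comp g x)]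
  simp only [map_sum, map_smul]
  simp only [gen, single_mul_grp, SkewMonoidAlgebra.smul_single]
  exact map_sum (SkewMonoidAlgebra.singleAddHom g) _ _

theorem toSkew_param (i j : Fin n) :
    toSkew (κ (b i) (b j)) = kap (coef b κ) (gen b) (grp K G V) i j :=
  toSkew_eq b _

/-- The projection `T(V) ⋊ G → H_{q,κ}`. -/
def proj : SkewTensor K G V →ₐ[K] H b q κ := RingQuot.mkAlgHom K (Rel b q κ)

theorem single_mul_sub (i j : Fin n) :
    SkewMonoidAlgebra.single 1 (TensorAlgebra.ι K (b i) * TensorAlgebra.ι K (b j)) -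
      (q i j • SkewMonoidAlgebra.single 1 (TensorAlgebra.ι K (b j) * TensorAlgebra.ι K (b i))
          + toSkew (κ (b i) (b j))) = rel q (coef b κ) (gen b) (grp K G V) i j := by
  rw [rel, toSkew_param, gen, gen, single_one_mul_single_one, single_one_mul_single_one, sub_sub]

theorem proj_rel (i j : Fin n) : proj b q κ (rel q (coef b κ) (gen b) (grp K G V) i j) = 0 := by
  rw [← single_mul_sub, map_sub, sub_eq_zero]
  exact RingQuot.mkAlgHom_rel K (Rel.relation i j)

theorem monomial_eq (p : (Fin n → ℕ) × G) :
    monomial b q κ p = proj b q κ (word (gen b) (normalWord p.1) * grp K G V p.2) := by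
  rw [word_gen, single_mul_grp, word_normalWord]
  rfl

theorem sub_mem_of_proj_eq {q κ} {S : Submodule K (SkewTensor K G V)}
    (hS : ∀ x y i j, x * rel q (coef b κ) (gen b) (grp K G V) i j * y ∈ S) {x : SkewTensor K G V}
    (h : proj b q κ x = 0) : x ∈ S := by
  have := sub_mem_of_mkAlgHom_eq (K := K) (r := Rel b q κ) (S := S) (x := x) (y := 0) ?_
    (h.trans (map_zero (proj b q κ)).symm)
  · simpa using this
  · rintro _ _ x y ⟨i, j⟩
    rw [single_mul_sub]
    exact hS x y i j

/-- As `N` depends only on the image under `f`, it lifts a linear relation among the `u i` back to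
one among the `v i`, which it fixes. -/
theorem linearIndependent_of_normalForm {R A M ι : Type*} [Ring R] [AddCommGroup A] [Module R A]
    [AddCommMonoid M] [Module R M] {v : ι → A} (hv : LinearIndependent R v) (N : A →ₗ[R] A)
    (hN : ∀ i, N (v i) = v i) (f : A →ₗ[R] M) (hf : ∀ x y, f x = f y → N x = N y) {u : ι → M}
    (hu : ∀ i, u i = f (v i)) : LinearIndependent R u := by
  have hcomp : ∀ l, Finsupp.linearCombination R u l = f (Finsupp.linearCombination R v l) := by
    intro l
    rw [Finsupp.linearCombination_apply, Finsupp.linearCombination_apply, map_finsuppSum]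
    simp [hu]
  have hfix : ∀ l, N (Finsupp.linearCombination R v l) = Finsupp.linearCombination R v l := by
    intro l
    rw [Finsupp.linearCombination_apply, map_finsuppSum]
    simp [hN]
  intro l l' h
  rw [hcomp, hcomp] at h
  have := hf _ _ h
  rw [hfix, hfix] at this
  exact hv this

/-- If all overlaps are resolvable, then `H_{q,κ}` has the PBW property. -/
theorem pbw_of_overlap [CharZero K] {χ : Fin n → G →* Kˣ}
    (hχ : ∀ (g : G) (i : Fin n), g • b i = (χ i g : K) • b i) {q κ} (hq : IsQuantumSystem q)
    (hc : IsParameter χ q (coef b κ))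
    (hΩ : ∀ i j k : Fin n, i ≠ j → j ≠ k → i ≠ k →
      overlap q (coef b κ) (gen b) (grp K G V) i j k ∈
        Submodule.span K {z | ∃ i j g,
          z = rel q (coef b κ) (gen b) (grp K G V) i j * grp K G V g}) :
    PBW b q κ := by
  have hX := skewCommutes (G := G) b hχ
  obtain ⟨β, hβ⟩ := exists_skewBasis (G := G) b
  obtain ⟨N, hN, hN'⟩ := hc.exists_normalForm hq hX hΩ β hβ
  have hmon : ∀ p, monomial b q κ p = proj b q κ (β (normalWord p.1, p.2)) := fun p => by
    rw [monomial_eq, hβ]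
  constructor
  · have hli : LinearIndependent K fun p : (Fin n → ℕ) × G => β (normalWord p.1, p.2) :=
      β.linearIndependent.comp (fun p : (Fin n → ℕ) × G => (normalWord p.1, p.2))
        (normalWord_injective.prodMap Function.injective_id)
    refine linearIndependent_of_normalForm hli N (fun p => hN' _ (pairwise_normalWord p.1))
      (proj b q κ).toLinearMap (fun x y h => ?_) hmon
    rw [← sub_eq_zero, ← map_sub]
    refine sub_mem_of_proj_eq b (S := LinearMap.ker N) (fun x y i j => hN x y i j) ?_
    rw [map_sub]
    exact sub_eq_zero.2 h
  · rw [eq_top_iff]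
    rintro y -
    obtain ⟨x, rfl⟩ : ∃ x, proj b q κ x = y := RingQuot.mkAlgHom_surjective K (Rel b q κ) y
    set S := Submodule.span K (Set.range (monomial b q κ))
    -- The preimage of the span contains all multiples of relations and all sorted words, hence
    -- every word.
    have hS : ∀ w g, word (gen b) w * grp K G V g ∈ S.comap (proj b q κ).toLinearMap := by
      refine word_mul_mem_of_sorted hX (q := q) (c := coef b κ) _ (fun x y i j => ?_)
        fun w g hw => Submodule.subset_span ⟨(fun i => w.count i, g), ?_⟩
      · simp [proj_rel]
      · rw [monomial_eq, normalWord_count hw]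
        rfl
    have htop : (⊤ : Submodule K (SkewTensor K G V)) ≤ S.comap (proj b q κ).toLinearMap := by
      rw [← β.span_eq, Submodule.span_le]
      rintro _ ⟨p, rfl⟩
      rw [hβ]
      exact hS _ _
    exact htop (Submodule.mem_top (x := x))

end Generators

/-! ### Equivalence of the PBW property with conditions (1), (2), (3). -/

section PBWConditions

variable {K : Type*} [Field K] {G : Type*} [CommGroup G] [Fintype G] {V : Type*} [AddCommGroup V]
  [Module K V] [DistribMulAction G V] [SMulCommClass G K V] {n : ℕ} (b : Module.Basis (Fin n) K V)
  {χ : Fin n → G →* Kˣ} {q : Fin n → Fin n → K} {κ : V →ₗ[K] V →ₗ[K] V ⊗[K] MonoidAlgebra K G}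

/-- The map `toSkew` as a linear map. -/
def toSkewLinear : V ⊗[K] MonoidAlgebra K G →ₗ[K] SkewTensor K G V where
  toFun := toSkew
  map_add' x y := by
    simp only [toSkew_eq b, map_add, Finsupp.add_apply, add_smul, Finset.sum_add_distrib]
  map_smul' s x := by
    simp only [toSkew_eq b, map_smul, Finsupp.smul_apply, smul_eq_mul, mul_smul, Finset.smul_sum,
      RingHom.id_apply]

theorem toSkewLinear_rightMul (h : G) (x : V ⊗[K] MonoidAlgebra K G) :
    toSkewLinear b (rightMul h x) = toSkewLinear b x * grp K G V h := by
  rw [← sum_tens_comp x]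
  simp only [map_sum, Finset.sum_mul, rightMul_tens]
  refine Finset.sum_congr rfl fun g _ => ?_
  change toSkew _ = toSkew _ * _
  rw [toSkew_tens, toSkew_tens, ← single_mul_grp _ g, mul_assoc, ← map_mul, single_mul_grp]

theorem grp_mul_toSkewLinear (h : G) (x : V ⊗[K] MonoidAlgebra K G) :
    grp K G V h * toSkewLinear b x * grp K G V h⁻¹ = toSkewLinear b (adjoint h x) := by
  rw [← sum_tens_comp x]
  simp only [map_sum, Finset.sum_mul, Finset.mul_sum, adjoint_tens]
  refine Finset.sum_congr rfl fun g _ => ?_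
  change _ * toSkew _ * _ = toSkew _
  rw [toSkew_tens, toSkew_tens, grp, SkewMonoidAlgebra.of_apply, SkewMonoidAlgebra.of_apply,
    SkewMonoidAlgebra.single_mul_single, SkewMonoidAlgebra.single_mul_single, smul_tensor_ι,
    one_mul, smul_one, mul_one]

theorem toSkewLinear_param (i j : Fin n) :
    toSkewLinear b (κ (b i) (b j)) = kap (coef b κ) (gen b) (grp K G V) i j :=
  toSkew_param b κ i j

theorem param_comp (i j k : Fin n) (g : G) :
    κ (b k) (comp g (κ (b i) (b j))) = ∑ r, coef b κ i j g r • κ (b k) (b r) := by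
  conv_lhs => rw [← b.sum_repr (comp g (κ (b i) (b j)))]
  simp only [map_sum, map_smul, coef]

variable (χ q κ) in
/-- The right-hand side of the third PBW condition. -/
def jacobiSum (i j k : Fin n) : V ⊗[K] MonoidAlgebra K G :=
  ∑ g : G, rightMul g
    (cyc (fun i j k => (((χ k g : K) - q j k) * coef b κ i j g i) • κ (b k) (b i)) i j k +
      cyc (fun i j k => q j k • κ (b k) (comp g (κ (b i) (b j)))) i j k)

/-- Identifies the linear part of the obstruction with the sum in condition (3). -/
theorem toSkewLinear_jacobiSum (i j k : Fin n) :
    toSkewLinear b (jacobiSum b χ q κ i j k) =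
      ∑ g, linearPart χ q (coef b κ) (gen b) (grp K G V) i j k g * grp K G V g := by
  simp only [jacobiSum, map_sum, toSkewLinear_rightMul, linearPart, cyc, map_add, map_smul,
    param_comp, toSkewLinear_param, add_mul, smul_mul_assoc, Finset.sum_mul]

/-- The quadratic coefficient of the obstruction is a unit times the expression in condition (2). -/
theorem quadratic_coef_eq (hq : IsQuantumSystem q) (c x : K) (i j k r : Fin n) :
    c * (q j k * q k r - q k i * x) = -q k i * ((x - q j k * q i k * q k r) * c) := by
  have h : q k i * q i k = 1 := hq.mul_swap k i
  linear_combination (-(c * q j k * q k r)) * h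

/-- The family `F` is arbitrary because it is evaluated both in a quotient space, for sufficiency,
and under a functional, for necessity. -/
theorem quadraticPart_eq_zero {M : Type*} [AddCommGroup M] [Module K M] (hq : IsQuantumSystem q)
    (h₂ : PBWCondition₂ b χ q κ) {i j k : Fin n} (hij : i ≠ j) (hjk : j ≠ k) (hik : i ≠ k) (g : G)
    (F : Fin n → Fin n → M) :
    cyc (fun i j k => ∑ r with r ≠ i ∧ r ≠ j,
      (coef b κ i j g r * (q j k * q k r - q k i * (χ k g : K))) • F r k) i j k +
      cyc (fun i j k => diagCoef χ q (coef b κ) i j k g • F k i) i j k = 0 := by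
  have hE : ∀ {i j k : Fin n}, i ≠ j → j ≠ k → i ≠ k → ∑ r with r ≠ i ∧ r ≠ j,
      (coef b κ i j g r * (q j k * q k r - q k i * (χ k g : K))) • F r k = 0 := by
    intro i j k hij hjk hik
    refine Finset.sum_eq_zero fun r hr => ?_
    simp only [Finset.mem_filter, Finset.mem_univ, true_and] at hr
    rw [quadratic_coef_eq hq, ← (h₂ g i j k hij hjk hik).1 r hr.1 hr.2]
    simp
  have hD : ∀ {i j k : Fin n}, i ≠ j → j ≠ k → i ≠ k →
      diagCoef χ q (coef b κ) i j k g = 0 := fun hij hjk hik =>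
    (h₂ g _ _ _ hij hjk hik).2.symm
  simp only [cyc, hE hij hjk hik, hE hjk hik.symm hij.symm, hE hik.symm hij hjk.symm,
    hD hij hjk hik, hD hjk hik.symm hij.symm, hD hik.symm hij hjk.symm]
  simp

/-- The three PBW conditions imply the PBW property. -/
theorem pbw_of_conditions [CharZero K]
    (hχ : ∀ (g : G) (i : Fin n), g • b i = (χ i g : K) • b i) (hq : IsQuantumSystem q)
    (hκ : QuantumAntisymmetric b q κ) (h₁ : Invariant κ) (h₂ : PBWCondition₂ b χ q κ)
    (h₃ : PBWCondition₃ b χ q κ) : PBW b q κ := by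
  refine pbw_of_overlap b hχ hq (isParameter b hχ hκ h₁) fun i j k hij hjk hik => ?_
  set S := Submodule.span K {z | ∃ i j g,
          z = rel q (coef b κ) (gen b) (grp K G V) i j * grp K G V g}
  have hf : ∀ i j g, S.mkQ (rel q (coef b κ) (gen b) (grp K G V) i j * grp K G V g) = 0 :=
    fun i j g => (Submodule.Quotient.mk_eq_zero S).2 (Submodule.subset_span ⟨i, j, g, rfl⟩)
  rw [← Submodule.Quotient.mk_eq_zero S, ← Submodule.mkQ_apply,
    map_overlap _ (skewCommutes b hχ) hq hf hij hjk hik, ← toSkewLinear_jacobiSum, jacobiSum,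
    ← h₃ i j k hij hjk hik, map_zero, map_zero, add_zero]
  exact Finset.sum_eq_zero fun g _ =>
    quadraticPart_eq_zero b hq h₂ hij hjk hik g fun s t => S.mkQ (gen b s * gen b t * grp K G V g)

/-- The PBW property allows to prescribe a functional on the sorted words. -/
theorem exists_functional_of_pbw (h : PBW b q κ) (l : List (Fin n) → G → K) :
    ∃ f : SkewTensor K G V →ₗ[K] K,
      (∀ x y i j, f (x * rel q (coef b κ) (gen b) (grp K G V) i j * y) = 0) ∧
      ∀ (w : List (Fin n)) (g : G), w.Pairwise (· ≤ ·) →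
        f (word (gen b) w * grp K G V g) = l w g := by
  let B := Module.Basis.mk h.1 h.2.ge
  let φ : H b q κ →ₗ[K] K := B.constr K fun p => l (normalWord p.1) p.2
  refine ⟨φ ∘ₗ (proj b q κ).toLinearMap, fun x y i j => ?_, fun w g hw => ?_⟩
  · simp [proj_rel]
  · have hB : proj b q κ (word (gen b) w * grp K G V g) = B (fun i => w.count i, g) := by
      rw [Module.Basis.mk_apply, monomial_eq, normalWord_count hw]
    change φ (proj b q κ (word (gen b) w * grp K G V g)) = _
    rw [hB, Module.Basis.constr_basis, normalWord_count hw]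

/-- One-letter words are sorted, so coordinates on `V ⊗ K G` extend to functionals vanishing on the
ideal. -/
theorem exists_linear_functional_of_pbw (h : PBW b q κ) (r : Fin n) (g : G) :
    ∃ f : SkewTensor K G V →ₗ[K] K,
      (∀ x y i j, f (x * rel q (coef b κ) (gen b) (grp K G V) i j * y) = 0) ∧
      ∀ x, f (toSkewLinear b x) = b.repr (comp g x) r := by
  classical
  obtain ⟨f, hf, hl⟩ := exists_functional_of_pbw b h fun w h => if w = [r] ∧ h = g then 1 else 0
  refine ⟨f, hf, fun x => ?_⟩
  have hgen : ∀ s h, f (gen b s * grp K G V h) = if s = r ∧ h = g then 1 else 0 := by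
    intro s h
    have := hl [s] h (List.pairwise_singleton _ _)
    simpa using this
  change f (toSkew x) = _
  simp only [toSkew_eq b, map_sum, map_smul, hgen]
  rw [Finset.sum_eq_single g, Finset.sum_eq_single r] <;> simp +contextual

/-- The value `1` is prescribed on whichever of `[s, t]`, `[t, s]` is sorted. Since `f` vanishes on
the linear part, swapping two letters only multiplies its value by some `q_ij`. -/
theorem exists_quadratic_functional_of_pbw (hq : IsQuantumSystem q) (h : PBW b q κ) (s t : Fin n)
    (g : G) :
    ∃ f : SkewTensor K G V →ₗ[K] K,
      (∀ x y i j, f (x * rel q (coef b κ) (gen b) (grp K G V) i j * y) = 0) ∧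
      (∀ x, f (toSkewLinear b x) = 0) ∧ f (gen b s * gen b t * grp K G V g) ≠ 0 ∧
      ∀ i j h, ¬ (h = g ∧ (i = s ∧ j = t ∨ i = t ∧ j = s)) →
        f (gen b i * gen b j * grp K G V h) = 0 := by
  classical
  obtain ⟨f, hf, hl⟩ := exists_functional_of_pbw b h fun w h =>
    if (w = [s, t] ∨ w = [t, s]) ∧ h = g then 1 else 0
  have hlin : ∀ x, f (toSkewLinear b x) = 0 := by
    intro x
    change f (toSkew x) = _
    have hgen : ∀ s h, f (gen b s * grp K G V h) = 0 := fun s h => by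
      simpa using hl [s] h (List.pairwise_singleton _ _)
    simp [toSkew_eq b, hgen]
  have hsort : ∀ i j h, i ≤ j → f (gen b i * gen b j * grp K G V h) =
      if ((i = s ∧ j = t) ∨ (i = t ∧ j = s)) ∧ h = g then 1 else 0 := fun i j h hij => by
    simpa using hl [i, j] h (by simpa using hij)
  have hswap : ∀ i j h, f (gen b i * gen b j * grp K G V h) =
      q i j * f (gen b j * gen b i * grp K G V h) := by
    intro i j h
    rw [map_mul_mul_of_rel (coef b κ) (fun i j g => by simpa using hf 1 (grp K G V g) i j),
      ← toSkewLinear_param, ← toSkewLinear_rightMul, hlin, add_zero, smul_eq_mul]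
  refine ⟨f, hf, hlin, ?_, fun i j h hn => ?_⟩
  · rcases le_total s t with hst | hst
    · simp [hsort _ _ _ hst]
    · rw [hswap, hsort _ _ _ hst]
      simpa using hq.ne_zero s t
  · rcases le_total i j with hij | hij
    · rw [hsort _ _ _ hij, if_neg]
      tauto
    · rw [hswap, hsort _ _ _ hij, if_neg, mul_zero]
      tauto

theorem map_overlap_eq_zero {f : SkewTensor K G V →ₗ[K] K}
    (hf : ∀ x y i j, f (x * rel q (coef b κ) (gen b) (grp K G V) i j * y) = 0) (i j k : Fin n) :
    f (overlap q (coef b κ) (gen b) (grp K G V) i j k) = 0 := by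
  have h1 : ∀ k i j, f (gen b k * rel q (coef b κ) (gen b) (grp K G V) i j) = 0 := fun k i j => by
    simpa using hf (gen b k) 1 i j
  have h2 : ∀ k i j, f (rel q (coef b κ) (gen b) (grp K G V) i j * gen b k) = 0 := fun k i j => by
    simpa using hf 1 (gen b k) i j
  rw [overlap_eq]
  simp [cyc, h1, h2]

/-- By `conj_rel` the defect of invariance is an element of `V ⊗ K G` lying in the ideal, so all
linear functionals vanish on it. -/
theorem invariant_of_pbw (hχ : ∀ (g : G) (i : Fin n), g • b i = (χ i g : K) • b i)
    (h : PBW b q κ) : Invariant κ := by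
  rw [invariant_iff b hχ]
  intro i j g r t
  obtain ⟨f, hf, hl⟩ := exists_linear_functional_of_pbw b h r g
  have e := congrArg f ((skewCommutes (G := G) b hχ).conj_rel q (coef b κ) i j t)
  have h0 : f (rel q (coef b κ) (gen b) (grp K G V) i j) = 0 := by simpa using hf 1 1 i j
  rw [map_sub, map_smul, hf, h0, ← toSkewLinear_param, grp_mul_toSkewLinear, map_sub, map_smul, hl,
    hl, comp_adjoint, repr_smul b hχ, smul_zero, sub_zero] at e
  exact sub_eq_zero.1 e.symm

theorem condition₂_of_pbw (hχ : ∀ (g : G) (i : Fin n), g • b i = (χ i g : K) • b i)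
    (hq : IsQuantumSystem q) (h : PBW b q κ) : PBWCondition₂ b χ q κ := by
  have hX := skewCommutes (G := G) b hχ
  have expand : ∀ {f : SkewTensor K G V →ₗ[K] K},
      (∀ x y i j, f (x * rel q (coef b κ) (gen b) (grp K G V) i j * y) = 0) →
      (∀ x, f (toSkewLinear b x) = 0) → ∀ {i j k : Fin n}, i ≠ j → j ≠ k → i ≠ k →
      ∑ g, (cyc (fun i j k => ∑ r with r ≠ i ∧ r ≠ j,
          (coef b κ i j g r * (q j k * q k r - q k i * (χ k g : K))) •
            f (gen b r * gen b k * grp K G V g)) i j k +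
        cyc (fun i j k => diagCoef χ q (coef b κ) i j k g •
          f (gen b k * gen b i * grp K G V g)) i j k) = 0 := by
    intro f hf hlin i j k hij hjk hik
    have := map_overlap (coef b κ) hX hq (f := f)
      (fun i j g => by simpa using hf 1 (grp K G V g) i j) hij hjk hik
    rw [map_overlap_eq_zero b hf, ← toSkewLinear_jacobiSum, hlin, add_zero] at this
    exact this.symm
  intro g i j k hij hjk hik
  constructor
  · intro r hri hrj
    -- As `r ≠ i, j`, the only monomial of the obstruction with letters `r`, `k` and group element
    -- `g` is `X_r X_k γ_g`.
    obtain ⟨f, hf, hlin, hne, hz⟩ := exists_quadratic_functional_of_pbw b hq h r k g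
    have hsum := expand hf hlin hij hjk hik
    rw [Finset.sum_eq_single g _ (by simp)] at hsum
    · simp only [cyc] at hsum
      rw [Finset.sum_eq_single r, Finset.sum_eq_zero, Finset.sum_eq_zero, hz k i g (by grind),
        hz i j g (by grind), hz j k g (by grind)] at hsum
      · simp only [smul_eq_mul, mul_zero, add_zero, quadratic_coef_eq hq] at hsum
        have := (mul_eq_zero.1 hsum).resolve_right hne
        exact ((mul_eq_zero.1 this).resolve_left (neg_ne_zero.2 (hq.ne_zero k i))).symm
      · intro s hs
        rw [hz s j g (by grind), smul_zero]
      · intro s hs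
        rw [hz s i g (by grind), smul_zero]
      · intro s hs hsr
        rw [hz s k g (by grind), smul_zero]
      · intro hr
        simp [hri, hrj] at hr
    · intro t _ ht
      simp [cyc, hz _ _ t (fun h => ht h.1)]
  -- The sums over `r` omit exactly the indices that could yield the letters `k`, `i`, so only the
  -- `diagCoef` term survives.
  · obtain ⟨f, hf, hlin, hne, hz⟩ := exists_quadratic_functional_of_pbw b hq h k i g
    have hsum := expand hf hlin hij hjk hik
    rw [Finset.sum_eq_single g _ (by simp)] at hsum
    · simp only [cyc] at hsum
      rw [Finset.sum_eq_zero, Finset.sum_eq_zero, Finset.sum_eq_zero,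
        hz i j g (by grind), hz j k g (by grind)] at hsum
      · simp only [smul_eq_mul, mul_zero, add_zero, zero_add] at hsum
        exact ((mul_eq_zero.1 hsum).resolve_right hne).symm
      · intro s hs
        rw [hz s j g (by grind), smul_zero]
      · intro s hs
        rw [hz s i g (by grind), smul_zero]
      · intro s hs
        rw [hz s k g (by grind), smul_zero]
    · intro t _ ht
      simp [cyc, hz _ _ t (fun h => ht h.1)]

/-- Condition (2) removes the quadratic part of the obstruction, and linear functionals then read
off each coordinate of what remains. -/
theorem condition₃_of_pbw (hχ : ∀ (g : G) (i : Fin n), g • b i = (χ i g : K) • b i)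
    (hq : IsQuantumSystem q) (h : PBW b q κ) : PBWCondition₃ b χ q κ := by
  have h₂ := condition₂_of_pbw b hχ hq h
  intro i j k hij hjk hik
  change 0 = jacobiSum b χ q κ i j k
  refine ext_comp fun g => b.repr.injective (Finsupp.ext fun r => ?_)
  obtain ⟨f, hf, hl⟩ := exists_linear_functional_of_pbw b h r g
  rw [← hl, ← hl, toSkewLinear_jacobiSum, map_zero, map_zero]
  have := map_overlap (coef b κ) (skewCommutes b hχ) hq (f := f)
      (fun i j g => by simpa using hf 1 (grp K G V g) i j) hij hjk hik
  rw [map_overlap_eq_zero b hf, Finset.sum_eq_zero, zero_add] at this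
  · exact this
  · exact fun g _ => quadraticPart_eq_zero b hq h₂ hij hjk hik g
      fun s t => f (gen b s * gen b t * grp K G V g)

end PBWConditions

/-! ### Comparison with the vanishing condition and the quantum Jacobi identity. -/

section Comparison

variable {K : Type*} [Field K] {G : Type*} [CommGroup G] [Fintype G] {V : Type*} [AddCommGroup V]
  [Module K V] [DistribMulAction G V] [SMulCommClass G K V] {n : ℕ} (b : Module.Basis (Fin n) K V)
  {χ : Fin n → G →* Kˣ} {q : Fin n → Fin n → K} {κ : V →ₗ[K] V →ₗ[K] V ⊗[K] MonoidAlgebra K G}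

theorem extend_tens_one (v : V) (y : V ⊗[K] MonoidAlgebra K G) :
    extend κ (tens v 1) y = ∑ h, rightMul h (κ v (comp h y)) := by
  classical
  rw [extend, Finset.sum_eq_single 1]
  · simp [comp_tens]
  · intro g _ hg
    simp [comp_tens, hg.symm]
  · simp

theorem condition₃_iff_quantumJacobi
    (h : ∀ (g : G) (i j k : Fin n), i ≠ j → j ≠ k → i ≠ k →
      ((χ k g : K) - q j k) * coef b κ i j g i = 0) :
    PBWCondition₃ b χ q κ ↔ QuantumJacobi b q κ := by
  have key : ∀ i j k : Fin n, i ≠ j → j ≠ k → i ≠ k → jacobiSum b χ q κ i j k =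
      cyc (fun i j k => q j k • extend κ (tens (b k) 1) (κ (b i) (b j))) i j k := by
    intro i j k hij hjk hik
    simp only [jacobiSum, cyc, extend_tens_one, h _ i j k hij hjk hik,
      h _ j k i hjk hik.symm hij.symm, h _ k i j hik.symm hij hjk.symm, zero_smul, add_zero,
      zero_add, map_add, map_smul, Finset.smul_sum, Finset.sum_add_distrib]
  refine forall_congr' fun i => forall_congr' fun j => forall_congr' fun k =>
    forall_congr' fun hij => forall_congr' fun hjk => forall_congr' fun hik => ?_
  rw [← key i j k hij hjk hik]
  exact eq_comm

theorem vanishing_iff (hχ : ∀ (g : G) (i : Fin n), g • b i = (χ i g : K) • b i) :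
    Vanishing b q κ ↔ ∀ (g : G) (i j k r : Fin n), i ≠ j → j ≠ k → i ≠ k →
      coef b κ i j g r ≠ 0 → (χ k g : K) = q i k * q j k * q k r := by
  simp only [Vanishing, hχ]
  refine forall_congr' fun g => forall_congr' fun i => forall_congr' fun j => forall_congr' fun k =>
    forall_congr' fun r => ?_
  rw [(smul_left_injective K (b.ne_zero k)).eq_iff]

/-- For `r = i` the prescribed eigenvalue `q_ik q_jk q_ki` collapses to `q_jk`. -/
theorem Vanishing.coef_left (hχ : ∀ (g : G) (i : Fin n), g • b i = (χ i g : K) • b i)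
    (hq : IsQuantumSystem q) (hv : Vanishing b q κ) (g : G) (i j k : Fin n) (hij : i ≠ j)
    (hjk : j ≠ k) (hik : i ≠ k) : ((χ k g : K) - q j k) * coef b κ i j g i = 0 := by
  by_cases h0 : coef b κ i j g i = 0
  · rw [h0, mul_zero]
  · rw [(vanishing_iff b hχ).1 hv g i j k i hij hjk hik h0]
    linear_combination (q j k * coef b κ i j g i) * hq.mul_swap i k

theorem Vanishing.condition₂ (hχ : ∀ (g : G) (i : Fin n), g • b i = (χ i g : K) • b i)
    (hq : IsQuantumSystem q) (hv : Vanishing b q κ) : PBWCondition₂ b χ q κ := by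
  intro g i j k hij hjk hik
  refine ⟨fun r _ _ => ?_, ?_⟩
  · by_cases h0 : coef b κ i j g r = 0
    · rw [h0, mul_zero]
    · rw [(vanishing_iff b hχ).1 hv g i j k r hij hjk hik h0]
      ring
  · have h1 := hv.coef_left b hχ hq g i j k hij hjk hik
    have h2 : (1 - q i j * (χ i g : K)) * coef b κ j k g k = 0 := by
      by_cases h0 : coef b κ j k g k = 0
      · rw [h0, mul_zero]
      -- The vanishing condition for `(j, k, i)` and `r = k` gives `χ_i(g) = q_ji`, so each summand
      -- of the second equation vanishes separately.
      · rw [(vanishing_iff b hχ).1 hv g j k i k hjk hik.symm hij.symm h0]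
        linear_combination (-coef b κ j k g k) *
          (hq.mul_swap i j + (q i j * q j i) * hq.mul_swap k i)
    linear_combination h1 - h2

/-- For a fixed point free action, the invariance of `κ` kills the coefficients of `v_i` and `v_j`
in `κ (v_i, v_j)`. -/
theorem Invariant.coef_eq_zero (hχ : ∀ (g : G) (i : Fin n), g • b i = (χ i g : K) • b i)
    (hfix : ∀ v : V, (∀ g : G, g • v = v) → v = 0) (hinv : Invariant κ) (i j : Fin n) (g : G) :
    coef b κ i j g i = 0 ∧ coef b κ i j g j = 0 := by
  -- If `χ_j` were trivial, `v_j` would be a nonzero fixed vector. For `r = i`, invariance reads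
  -- `χ_i χ_j c = χ_i c`, so some `χ_j(h) ≠ 1` forces `c = 0`.
  have hne : ∀ j, ∃ h : G, (χ j h : K) ≠ 1 := by
    intro j
    by_contra! hall
    exact b.ne_zero j (hfix _ fun g => by rw [hχ, hall, one_smul])
  have H := (invariant_iff b hχ).1 hinv i j g
  constructor
  · obtain ⟨h, hh⟩ := hne j
    have hu : (χ i h : K) ≠ 0 := (χ i h).ne_zero
    have : ((χ i h : K) * (χ j h - 1)) * coef b κ i j g i = 0 := by linear_combination H i h
    exact (mul_eq_zero.1 this).resolve_left (mul_ne_zero hu (sub_ne_zero.2 hh))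
  · obtain ⟨h, hh⟩ := hne i
    have hu : (χ j h : K) ≠ 0 := (χ j h).ne_zero
    have : ((χ j h : K) * (χ i h - 1)) * coef b κ i j g j = 0 := by linear_combination H j h
    exact (mul_eq_zero.1 this).resolve_left (mul_ne_zero hu (sub_ne_zero.2 hh))

/-- Condition (2) gives the eigenvalue only for `r ≠ i, j`; in the excluded cases the coefficient is
zero. -/
theorem vanishing_of_condition₂ (hχ : ∀ (g : G) (i : Fin n), g • b i = (χ i g : K) • b i)
    (hfix : ∀ v : V, (∀ g : G, g • v = v) → v = 0) (hinv : Invariant κ)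
    (h₂ : PBWCondition₂ b χ q κ) : Vanishing b q κ := by
  rw [vanishing_iff b hχ]
  intro g i j k r hij hjk hik h0
  have hc := hinv.coef_eq_zero b hχ hfix i j g
  have hri : r ≠ i := fun h => h0 (h ▸ hc.1)
  have hrj : r ≠ j := fun h => h0 (h ▸ hc.2)
  have := (mul_eq_zero.1 ((h₂ g i j k hij hjk hik).1 r hri hrj).symm).resolve_right h0
  linear_combination this

end Comparison

end

end QuantumDrinfeld

open QuantumDrinfeld in
theorem corollary3p5 {K : Type*} [Field K] [CharZero K] {G : Type*} [CommGroup G] [Fintype G]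
    {V : Type*} [AddCommGroup V] [Module K V] [DistribMulAction G V] [SMulCommClass G K V]
    {n : ℕ} (b : Module.Basis (Fin n) K V)
    (χ : Fin n → G →* Kˣ) (hχ : ∀ (g : G) (i : Fin n), g • b i = (χ i g : K) • b i)
    (q : Fin n → Fin n → K) (hq : IsQuantumSystem q)
    (κ : V →ₗ[K] V →ₗ[K] V ⊗[K] MonoidAlgebra K G) (hκ : QuantumAntisymmetric b q κ) :
    (Invariant κ ∧ Vanishing b q κ ∧ QuantumJacobi b q κ →
      (Invariant κ ∧ PBWCondition₂ b χ q κ ∧ PBWCondition₃ b χ q κ) ∧ PBW b q κ) ∧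
    ((∀ v : V, (∀ g : G, g • v = v) → v = 0) →
      ((Invariant κ ∧ PBWCondition₂ b χ q κ ∧ PBWCondition₃ b χ q κ) ↔
        (Invariant κ ∧ Vanishing b q κ ∧ QuantumJacobi b q κ)) ∧
      (PBW b q κ ↔ Invariant κ ∧ Vanishing b q κ ∧ QuantumJacobi b q κ)) := by
  have hprime : Vanishing b q κ ∧ QuantumJacobi b q κ →
      PBWCondition₂ b χ q κ ∧ PBWCondition₃ b χ q κ := fun ⟨hv, hj⟩ =>
    ⟨hv.condition₂ b hχ hq,
      (condition₃_iff_quantumJacobi b (hv.coef_left b hχ hq)).2 hj⟩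
  -- This equivalence holds for every diagonal action, fixed point free or not.
  have hpbw : Invariant κ ∧ PBWCondition₂ b χ q κ ∧ PBWCondition₃ b χ q κ ↔ PBW b q κ :=
    ⟨fun ⟨h₁, h₂, h₃⟩ => pbw_of_conditions b hχ hq hκ h₁ h₂ h₃, fun h =>
      ⟨invariant_of_pbw b hχ h, condition₂_of_pbw b hχ hq h, condition₃_of_pbw b hχ hq h⟩⟩
  refine ⟨fun ⟨hinv, h⟩ => ⟨⟨hinv, hprime h⟩, hpbw.1 ⟨hinv, hprime h⟩⟩, fun hfix => ?_⟩
  have hiff : (Invariant κ ∧ PBWCondition₂ b χ q κ ∧ PBWCondition₃ b χ q κ) ↔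
      (Invariant κ ∧ Vanishing b q κ ∧ QuantumJacobi b q κ) := by
    refine and_congr_right fun hinv => ⟨fun ⟨h₂, h₃⟩ => ?_, hprime⟩
    refine ⟨vanishing_of_condition₂ b hχ hfix hinv h₂,
      (condition₃_iff_quantumJacobi b fun g i j k _ _ _ => ?_).1 h₃⟩
    rw [(hinv.coef_eq_zero b hχ hfix i j g).1, mul_zero]
  exact ⟨hiff, hpbw.symm.trans hiff⟩
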